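/- Let $k$ be a field and let $d\ge 1$. A $d$-graph $H$ consists of a finite vertex set $V(H)\subseteq\mathbb Z$ and a set $E(H)$ of $d$-element subsets of $V(H)$ (edges). For $d\ge 2$ and $v\in V(H)$, the $v$-layer of $H$ is the $(d-1)$-graph with vertex set $\{w\in V(H): w>v\}$ and edge set $\{e : e\cup\{v\}\in E(H),\ v<w \text{ for all } w\in e\}$. Every $1$-graph is cointerval; for $d\ge2$, $H$ is cointerval if all of its layers are cointerval and, for all vertices $i<j$, the $j$-layer is a subgraph of the $i$-layer. For $\alpha\subseteq V(H)$, $H[\alpha]$ is the induced subgraph, with vertex set $\alpha$ and edges $\{e\in E(H): e\subseteq\alpha\}$. Let $S=k[x_v: v\in V(H)]$ with its $\mathbb Z^{V(H)}$-grading, and let $I_H=\langle \prod_{v\in e}x_v : e\in E(H)\rangle$ be the edge ideal. Let $\Delta_\sigma$ be the simplex with vertex set $\sigma$. The polyhedral complex $X_H$ is the subcomplex of $\prod_{i=1}^d\Delta_{V(H)}$ whose cells are the products $\Delta_{\sigma_1}\times\cdots\times\Delta_{\sigma_d}$ with $\emptyset\ne\sigma_i\subseteq V(H)$, $\sigma_1<\cdots<\sigma_d$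 (that is, $s<t$ whenever $s\in\sigma_i$, $t\in\sigma_j$, $i<j$), such that $\{v_1,\dots,v_d\}\in E(H)$ for every choice of $v_i\in\sigma_i$. The vertex $v_1\times\cdots\times v_d$ is labeled by the monomial $x_{v_1}\cdots x_{v_d}$, and each face $F$ by the least common multiple $x^{\ell(F)}$ of the labels of its vertices. For an orientation of $X_H$, its cellular free complex has a basis element of homological degree $\dim F$ and multidegree $\ell(F)$ for each face $F$, with differential $\partial F=\sum_G \pm x^{\ell(F)-\ell(G)}\,G$ over the facets $G$ of $F$, with the incidence signs of the orientation; a vertex $F$ is mapped to $x^{\ell(F)}\in S$. Theorem. If $H$ is a cointerval $d$-graph, then $X_H$ supports a minimal cellular resolution of $I_H$: for each orientation of $X_H$, the cellular free complex is a minimal $\mathbb Z^{V(H)}$-graded free resolution of $I_H$ over $S$. In particular, let $\beta_{i,\alpha}(I_H)$ be the number of summands $S(-\alpha)$ in homological degree $i$ of any minimal graded free resolution $\cdots\to F_1\to F_0\to I_H\to 0$. Then for all $i\ge 0$ and $\alpha\subseteq V(H)$ (identified with its indicator vector), $\beta_{i,\alpha}(I_H)=0$ if $i\neq|\alpha|-d$,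 and if $i=|\alpha|-d$ then $$\beta_{i,\alpha}(I_H)=\bigl|\{F\in X_{H[\alpha]} : \dim F=|\alpha|-d\}\bigr|.$$ In other words, for all $i\ge0$ and $\alpha\in\mathbb Z^{V(H)}$, $\beta_{i,\alpha}(I_H)$ is the number of faces of $X_H$ of dimension $i$ with monomial label $\alpha$. -/

import Mathlib

/-! ### Uniform hypergraphs with integer vertices -/

/-- A `d`-graph: a finite vertex set `verts ⊆ ℤ` with a collection of `d`-element subsets. -/
structure DGraph (d : ℕ) where
  verts : Finset ℤ
  edges : Finset (Finset ℤ)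
  edge_subset : ∀ e ∈ edges, e ⊆ verts
  edge_card : ∀ e ∈ edges, e.card = d

namespace DGraph

/-- The `v`-layer of a `(d+1)`-graph: the `d`-graph on the vertices larger than `v` whose edges are
the sets `e` of vertices larger than `v` such that `{v} ∪ e` is an edge. -/
def layer {d : ℕ} (H : DGraph (d + 1)) (v : ℤ) : DGraph d where
  verts := H.verts.filter (fun w => v < w)
  edges := ((H.verts.filter (fun w => v < w)).powersetCard d).filter (fun e => insert v e ∈ H.edges)
  edge_subset := fun _ he => (Finset.mem_powersetCard.1 (Finset.mem_filter.1 he).1).1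
  edge_card := fun _ he => (Finset.mem_powersetCard.1 (Finset.mem_filter.1 he).1).2

/-- The induced subgraph `H[W]` for `W ⊆ V(H)`. -/
def induce {d : ℕ} (H : DGraph d) (W : Finset ℤ) (_hW : W ⊆ H.verts) : DGraph d where
  verts := W
  edges := H.edges.filter (fun e => e ⊆ W)
  edge_subset := fun _ he => (Finset.mem_filter.1 he).2
  edge_card := fun e he => H.edge_card e (Finset.mem_filter.1 he).1

/-- `G` is a subgraph of `H`. -/
def IsSubgraph {d : ℕ} (G H : DGraph d) : Prop :=
  G.verts ⊆ H.verts ∧ G.edges ⊆ H.edges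

/-- Cointerval `d`-graphs, by recursion on `d ≥ 1` (no `0`-graph is called cointerval). -/
def IsCointerval : {d : ℕ} → DGraph d → Prop
  | 0, _ => False
  | 1, _ => True
  | _ + 2, H =>
      (∀ i ∈ H.verts, (H.layer i).IsCointerval) ∧
        ∀ i ∈ H.verts, ∀ j ∈ H.verts, i < j → (H.layer j).IsSubgraph (H.layer i)

/-- The edge ideal of `H` in the polynomial ring whose variables are the vertices of `H`. -/
noncomputable def edgeIdeal (k : Type*) [Field k] {d : ℕ} (H : DGraph d) :
    Ideal (MvPolynomial H.verts k) :=
  Ideal.span {m | ∃ e ∈ H.edges,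
    m = ∏ v ∈ Finset.univ.filter (fun v : H.verts => (v : ℤ) ∈ e), MvPolynomial.X v}

end DGraph

/-! ### Multigraded free resolutions

`S = k[x_v : v ∈ σ]` is graded by `ℤ^σ`. -/

/-- A sequence `⋯ → F₂ → F₁ → F₀ → S` of `ℤ^σ`-graded homomorphisms, where
`F i = ⨁_b S(-deg b)` is a free module of finite rank with basis `gen i`.  The maps are given by
matrices; being of degree zero means that the `(a, b)` entry is a scalar multiple of the monomial
with exponent vector `deg b - deg a`. -/
structure GradedFreeSequence (k : Type*) [Field k] (σ : Type*) where
  gen : ℕ → Type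
  [fintypeGen : ∀ i, Fintype (gen i)]
  deg : ∀ i, gen i → σ → ℤ
  diff : ∀ i, Matrix (gen i) (gen (i + 1)) (MvPolynomial σ k)
  aug : gen 0 → MvPolynomial σ k
  diff_homogeneous : ∀ i a b, ∀ m ∈ (diff i a b).support, ∀ v,
    (m v : ℤ) = deg (i + 1) b v - deg i a v
  aug_homogeneous : ∀ a, ∀ m ∈ (aug a).support, ∀ v, (m v : ℤ) = deg 0 a v

attribute [instance] GradedFreeSequence.fintypeGen

namespace GradedFreeSequence

variable {k : Type*} [Field k] {σ : Type*}

/-- The sequence is a free resolution of the ideal `I`: the image of `F₀ → S` is `I`, and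
`⋯ → F₂ → F₁ → F₀ → I → 0` is exact. -/
def IsFreeResolution (F : GradedFreeSequence k σ) (I : Ideal (MvPolynomial σ k)) : Prop :=
  LinearMap.range (Fintype.linearCombination (MvPolynomial σ k) F.aug) = I ∧
  Function.Exact (F.diff 0).mulVecLin (Fintype.linearCombination (MvPolynomial σ k) F.aug) ∧
  ∀ i, Function.Exact (F.diff (i + 1)).mulVecLin (F.diff i).mulVecLin

/-- Minimality: `F (i+1)` is mapped into `𝔪 F i`, where `𝔪` is generated by the variables. -/
def IsMinimal (F : GradedFreeSequence k σ) : Prop :=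
  ∀ i a b, F.diff i a b ∈ Ideal.span (Set.range (MvPolynomial.X : σ → MvPolynomial σ k))

/-- The number of summands `S(-α)` in homological degree `i`. -/
noncomputable def rank (F : GradedFreeSequence k σ) (i : ℕ) (α : σ → ℤ) : ℕ :=
  Nat.card {b : F.gen i // F.deg i b = α}

end GradedFreeSequence

/-- The finely graded Betti number `β_{i,α}(I)` equals `n`: the ideal `I` has a minimal graded free
resolution, and each such resolution has exactly `n` summands `S(-α)` in homological degree `i`. -/
def IsBettiNumber {k : Type*} [Field k] {σ : Type*} (I : Ideal (MvPolynomial σ k))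
    (i : ℕ) (α : σ → ℤ) (n : ℕ) : Prop :=
  (∃ F : GradedFreeSequence k σ, F.IsFreeResolution I ∧ F.IsMinimal) ∧
  ∀ F : GradedFreeSequence k σ, F.IsFreeResolution I → F.IsMinimal → F.rank i α = n

/-! ### Labeled polyhedral complexes and their cellular complexes -/

/-- A finite polyhedral complex in a real topological vector space: finitely many nonempty
polytopes (the cells), closed under taking nonempty faces, any two of which meet in a common face.
The nonempty faces of a polytope are its nonempty exposed subsets. -/
structure PolyhedralComplex (E : Type*) [AddCommGroup E] [Module ℝ E] [TopologicalSpace E] where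
  Face : Type
  [fintypeFace : Fintype Face]
  carrier : Face → Set E
  carrier_injective : Function.Injective carrier
  polytope : ∀ F, ∃ s : Set E, s.Finite ∧ s.Nonempty ∧ carrier F = convexHull ℝ s
  face_mem : ∀ F B, B.Nonempty → IsExposed ℝ (carrier F) B → ∃ G, carrier G = B
  inter_exposed : ∀ F G, IsExposed ℝ (carrier F) (carrier F ∩ carrier G)

attribute [instance] PolyhedralComplex.fintypeFace

namespace PolyhedralComplex

variable {E : Type*} [AddCommGroup E] [Module ℝ E] [TopologicalSpace E]

/-- The dimension of (the affine hull of) a cell. -/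
noncomputable def dim (X : PolyhedralComplex E) (F : X.Face) : ℕ :=
  Module.finrank ℝ (vectorSpan ℝ (X.carrier F))

/-- `G` is a facet of `F`. -/
def IsFacet (X : PolyhedralComplex E) (G F : X.Face) : Prop :=
  X.carrier G ⊆ X.carrier F ∧ X.dim F = X.dim G + 1

/-- An orientation of the cells (vertices being oriented positively), recorded by its incidence
function: `sign F G = ±1` for a facet `G` of `F`, according to whether the orientation of `F`
induces that of `G`. -/
structure Orientation (X : PolyhedralComplex E) where
  sign : X.Face → X.Face → ℤ
  sign_of_isFacet : ∀ F G, X.IsFacet G F → sign F G = 1 ∨ sign F G = -1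
  sign_of_not_isFacet : ∀ F G, ¬ X.IsFacet G F → sign F G = 0
  sum_sign_edge : ∀ F, X.dim F = 1 → ∑ G, sign F G = 0
  sum_sign_mul_sign : ∀ F G, ∑ K, sign F K * sign K G = 0

end PolyhedralComplex

/-- A polyhedral complex with vertices labeled by monomials in the variables `x_v`, `v ∈ σ`
(a monomial is given by its exponent vector). -/
structure LabeledPolyhedralComplex (E : Type*) [AddCommGroup E] [Module ℝ E] [TopologicalSpace E]
    (σ : Type*) extends PolyhedralComplex E where
  vertexLabel : {G : Face // toPolyhedralComplex.dim G = 0} → σ →₀ ℕ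

namespace LabeledPolyhedralComplex

variable {E : Type*} [AddCommGroup E] [Module ℝ E] [TopologicalSpace E] {σ : Type*}

open Classical in
/-- The label of a face: the least common multiple of the labels of its vertices. -/
noncomputable def label (X : LabeledPolyhedralComplex E σ) (F : X.Face) : σ →₀ ℕ :=
  (Finset.univ.filter (fun G : {G : X.Face // X.dim G = 0} =>
    X.carrier G.1 ⊆ X.carrier F)).sup X.vertexLabel

theorem label_mono (X : LabeledPolyhedralComplex E σ) {G F : X.Face}
    (h : X.carrier G ⊆ X.carrier F) : X.label G ≤ X.label F := by
  classical
  unfold label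
  apply Finset.sup_mono
  intro v hv
  simp only [Finset.mem_filter, Finset.mem_univ, true_and] at hv ⊢
  exact hv.trans h

open Classical in
/-- The cellular free complex of `X`: a basis element of degree `label F` in homological degree
`dim F` for each face `F`, with `∂ F = ∑ sign(F, G) • x^(label F - label G) • G` over the
facets `G` of `F`; a vertex is sent to its label in `S`. -/
noncomputable def cellularComplex (X : LabeledPolyhedralComplex E σ) (k : Type*) [Field k]
    (o : X.Orientation) : GradedFreeSequence k σ where
  gen := fun i => {F : X.Face // X.dim F = i}
  deg := fun _ F v => (X.label F.1 v : ℤ)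
  diff := fun _ => Matrix.of fun G F =>
    MvPolynomial.monomial (X.label F.1 - X.label G.1) ((o.sign F.1 G.1 : ℤ) : k)
  aug := fun F => MvPolynomial.monomial (X.label F.1) 1
  diff_homogeneous := by
    intro i G F m hm v
    by_cases hf : X.IsFacet G.1 F.1
    · have hm' := MvPolynomial.support_monomial_subset hm
      rw [Finset.mem_singleton] at hm'
      have hle := X.label_mono hf.1 v
      rw [hm', Finsupp.tsub_apply, Nat.cast_sub hle]
    · simp [o.sign_of_not_isFacet _ _ hf] at hm
  aug_homogeneous := by
    intro F m hm v
    have hm' := MvPolynomial.support_monomial_subset hm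
    rw [Finset.mem_singleton] at hm'
    rw [hm']

/-- `X` supports a minimal cellular resolution of `I`: `X` can be oriented, and for each
orientation its cellular free complex is a minimal free resolution of `I`. -/
def SupportsMinimalResolution (X : LabeledPolyhedralComplex E σ) {k : Type*} [Field k]
    (I : Ideal (MvPolynomial σ k)) : Prop :=
  Nonempty X.Orientation ∧
  ∀ o : X.Orientation, (X.cellularComplex k o).IsFreeResolution I ∧ (X.cellularComplex k o).IsMinimal

end LabeledPolyhedralComplex

/-! ### Products of simplices -/

/-- The face `Δ_s` of the standard simplex `Δ_V` in `ℝ^V`. -/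
def simplexFace {V : Type*} [DecidableEq V] (s : Finset V) : Set (V → ℝ) :=
  convexHull ℝ ((fun v => Pi.single v (1 : ℝ)) '' (s : Set V))

theorem mem_simplexFace {V : Type*} [Fintype V] [DecidableEq V] {s : Finset V} {x : V → ℝ} :
    x ∈ simplexFace s ↔ (∀ v, 0 ≤ x v) ∧ ∑ v, x v = 1 ∧ ∀ v, v ∉ s → x v = 0 := by
  constructor
  · intro hx
    have hconv : Convex ℝ {x : V → ℝ | (∀ v, 0 ≤ x v) ∧ ∑ v, x v = 1 ∧ ∀ v, v ∉ s → x v = 0} := by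
      rintro x ⟨hx0, hx1, hxs⟩ y ⟨hy0, hy1, hys⟩ a b ha hb hab
      refine ⟨fun v => ?_, ?_, fun v hv => ?_⟩
      · have := mul_nonneg ha (hx0 v)
        have := mul_nonneg hb (hy0 v)
        simp only [Pi.add_apply, Pi.smul_apply, smul_eq_mul]
        linarith
      · simp only [Pi.add_apply, Pi.smul_apply, smul_eq_mul, Finset.sum_add_distrib,
          ← Finset.mul_sum, hx1, hy1]
        linarith
      · simp [hxs v hv, hys v hv]
    refine convexHull_min ?_ hconv hx
    rintro _ ⟨w, hw, rfl⟩
    refine ⟨fun v => ?_, by simp, fun v hv => ?_⟩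
    · by_cases h : v = w
      · subst h; simp
      · simp [Pi.single_eq_of_ne h]
    · have h : v ≠ w := fun h => hv (h ▸ hw)
      simp [Pi.single_eq_of_ne h]
  · rintro ⟨h0, h1, hs⟩
    have hx : x = ∑ v ∈ s, x v • (Pi.single v (1 : ℝ) : V → ℝ) := by
      funext w
      simp only [Finset.sum_apply, Pi.smul_apply, smul_eq_mul, Pi.single_apply, mul_ite, mul_one,
        mul_zero, Finset.sum_ite_eq]
      split_ifs with h
      · rfl
      · exact hs w h
    rw [hx]
    refine (convex_convexHull ℝ _).sum_mem (fun v _ => h0 v) ?_ (fun v hv => ?_)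
    · rw [← h1]
      exact Finset.sum_subset (Finset.subset_univ s) (fun v _ hv => hs v hv)
    · exact subset_convexHull ℝ _ ⟨v, hv, rfl⟩

/-- The cell `φ 0 × φ 1 × ⋯` of the product of simplices `∏ Δ_V`. -/
def prodCell {V : Type*} [DecidableEq V] {d : ℕ} (φ : Fin d → Finset V) : Set (Fin d → V → ℝ) :=
  Set.pi Set.univ (fun i => simplexFace (φ i))

theorem mem_prodCell {V : Type*} [Fintype V] [DecidableEq V] {d : ℕ} {φ : Fin d → Finset V}
    {x : Fin d → V → ℝ} :
    x ∈ prodCell φ ↔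
      ∀ i, (∀ v, 0 ≤ x i v) ∧ ∑ v, x i v = 1 ∧ ∀ v, v ∉ φ i → x i v = 0 := by
  simp [prodCell, Set.mem_pi, mem_simplexFace]

theorem vertex_mem_prodCell {V : Type*} [Fintype V] [DecidableEq V] {d : ℕ}
    {φ : Fin d → Finset V} {w : Fin d → V} (hw : ∀ i, w i ∈ φ i) :
    (fun i => Pi.single (w i) (1 : ℝ)) ∈ prodCell φ :=
  Set.mem_univ_pi.2 fun i => subset_convexHull ℝ _ ⟨w i, hw i, rfl⟩

theorem prodCell_subset {V : Type*} [Fintype V] [DecidableEq V] {d : ℕ}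
    {φ ψ : Fin d → Finset V} (hφ : ∀ i, (φ i).Nonempty) (h : prodCell φ ⊆ prodCell ψ) (i : Fin d) :
    φ i ⊆ ψ i := by
  intro v hv
  choose w hw using hφ
  have hmem := h (vertex_mem_prodCell (φ := φ) (w := Function.update w i v) (by
    intro j
    by_cases hj : j = i
    · subst hj; simpa using hv
    · simpa [Function.update_of_ne hj] using hw j))
  by_contra hcon
  have := (mem_prodCell.1 hmem i).2.2 v hcon
  simp at this

theorem prodCell_injective {V : Type*} [Fintype V] [DecidableEq V] {d : ℕ}
    {φ ψ : Fin d → Finset V} (hφ : ∀ i, (φ i).Nonempty) (hψ : ∀ i, (ψ i).Nonempty)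
    (h : prodCell φ = prodCell ψ) : φ = ψ :=
  funext fun i => (prodCell_subset hφ h.le i).antisymm (prodCell_subset hψ h.ge i)

theorem prodCell_polytope {V : Type*} [DecidableEq V] {d : ℕ}
    {φ : Fin d → Finset V} (hφ : ∀ i, (φ i).Nonempty) :
    ∃ s : Set (Fin d → V → ℝ), s.Finite ∧ s.Nonempty ∧ prodCell φ = convexHull ℝ s := by
  refine ⟨Set.pi Set.univ fun i => (fun v => Pi.single v (1 : ℝ)) '' (φ i : Set V),
    Set.Finite.pi fun i => (φ i).finite_toSet.image _, ?_, ?_⟩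
  · choose w hw using hφ
    exact ⟨fun i => Pi.single (w i) 1, Set.mem_univ_pi.2 fun i => ⟨w i, hw i, rfl⟩⟩
  · rw [convexHull_pi]; rfl

theorem prodCell_inter {V : Type*} [Fintype V] [DecidableEq V] {d : ℕ}
    (φ ψ : Fin d → Finset V) :
    IsExposed ℝ (prodCell φ) (prodCell φ ∩ prodCell ψ) := by
  rintro ⟨z, hzφ, hzψ⟩
  let l : StrongDual ℝ (Fin d → V → ℝ) :=
    ∑ i, ∑ v ∈ ψ i, (ContinuousLinearMap.proj v).comp
      (ContinuousLinearMap.proj (R := ℝ) (φ := fun _ : Fin d => V → ℝ) i)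
  have hl : ∀ x, l x = ∑ i, ∑ v ∈ ψ i, x i v := by
    intro x
    simp [l]
  have hle : ∀ x ∈ prodCell φ, ∀ i, ∑ v ∈ ψ i, x i v ≤ 1 := by
    intro x hx i
    obtain ⟨h0, h1, -⟩ := mem_prodCell.1 hx i
    rw [← h1]
    exact Finset.sum_le_sum_of_subset_of_nonneg (Finset.subset_univ _) fun v _ _ => h0 v
  have heq : ∀ x ∈ prodCell ψ, ∀ i, ∑ v ∈ ψ i, x i v = 1 := by
    intro x hx i
    obtain ⟨h0, h1, h2⟩ := mem_prodCell.1 hx i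
    rw [← h1]
    exact Finset.sum_subset (Finset.subset_univ _) fun v _ hv => h2 v hv
  refine ⟨l, Set.ext fun x => ⟨?_, ?_⟩⟩
  · rintro ⟨hxφ, hxψ⟩
    refine ⟨hxφ, fun y hy => ?_⟩
    rw [hl, hl]
    refine Finset.sum_le_sum fun i _ => ?_
    rw [heq x hxψ i]
    exact hle y hy i
  · rintro ⟨hxφ, hmax⟩
    refine ⟨hxφ, mem_prodCell.2 fun i => ?_⟩
    obtain ⟨h0, h1, -⟩ := mem_prodCell.1 hxφ i
    refine ⟨h0, h1, fun v hv => ?_⟩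
    have hz := hmax z hzφ
    rw [hl, hl] at hz
    have hall : ∑ i, ∑ v ∈ ψ i, x i v = ∑ i, ∑ v ∈ ψ i, z i v := by
      refine le_antisymm (Finset.sum_le_sum fun i _ => ?_) hz
      rw [heq z hzψ i]
      exact hle x hxφ i
    have hi := (Finset.sum_eq_sum_iff_of_le (fun i _ => by
      rw [heq z hzψ i]; exact hle x hxφ i)).1 hall i (Finset.mem_univ i)
    rw [heq z hzψ i] at hi
    have hsplit := Finset.sum_add_sum_compl (ψ i) (x i)
    rw [h1, hi] at hsplit
    have hcompl : ∑ v ∈ (ψ i)ᶜ, x i v = 0 := by linarith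
    exact (Finset.sum_eq_zero_iff_of_nonneg fun v _ => h0 v).1 hcompl v (by simpa using hv)

theorem prodCell_face {V : Type*} [Fintype V] [DecidableEq V] {d : ℕ}
    {φ : Fin d → Finset V} (hφ : ∀ i, (φ i).Nonempty) {B : Set (Fin d → V → ℝ)}
    (hB : B.Nonempty) (h : IsExposed ℝ (prodCell φ) B) :
    ∃ ψ : Fin d → Finset V, (∀ i, (ψ i).Nonempty ∧ ψ i ⊆ φ i) ∧ prodCell ψ = B := by
  classical
  obtain ⟨l, rfl⟩ := h hB
  let e : Fin d → V → (Fin d → V → ℝ) := fun i v => Pi.single i (Pi.single v 1)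
  let c : Fin d → V → ℝ := fun i v => l (e i v)
  have hl : ∀ x, l x = ∑ i, ∑ v, x i v * c i v := by
    intro x
    have hx : x = ∑ i, ∑ v, x i v • e i v := by
      funext j w
      simp only [e, Finset.sum_apply, Pi.smul_apply, smul_eq_mul]
      rw [Finset.sum_eq_single j, Finset.sum_eq_single w]
      · simp
      · intro v _ hv; simp [Pi.single_eq_of_ne hv.symm]
      · simp
      · intro i _ hi; simp [Pi.single_eq_of_ne hi.symm]
      · simp
    conv_lhs => rw [hx]
    simp [map_sum, c]
  have hmaxc : ∀ i, ∃ w ∈ φ i, ∀ v ∈ φ i, c i v ≤ c i w := fun i =>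
    (φ i).exists_max_image (c i) (hφ i)
  choose w hw hwmax using hmaxc
  refine ⟨fun i => (φ i).filter fun v => c i v = c i (w i), fun i =>
    ⟨⟨w i, Finset.mem_filter.2 ⟨hw i, rfl⟩⟩, Finset.filter_subset _ _⟩, Set.ext fun x => ⟨?_, ?_⟩⟩
  · intro hx
    have hxφ : x ∈ prodCell φ := mem_prodCell.2 fun i => by
      obtain ⟨h0, h1, h2⟩ := mem_prodCell.1 hx i
      exact ⟨h0, h1, fun v hv => h2 v fun hv' => hv (Finset.mem_filter.1 hv').1⟩
    refine ⟨hxφ, fun y hy => ?_⟩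
    rw [hl, hl]
    refine Finset.sum_le_sum fun i _ => ?_
    obtain ⟨-, hx1, hx2⟩ := mem_prodCell.1 hx i
    obtain ⟨hy0, hy1, hy2⟩ := mem_prodCell.1 hy i
    have h1 : ∑ v, x i v * c i v = c i (w i) := by
      rw [← one_mul (c i (w i)), ← hx1, Finset.sum_mul]
      refine Finset.sum_congr rfl fun v _ => ?_
      by_cases hv : v ∈ (φ i).filter fun v => c i v = c i (w i)
      · rw [(Finset.mem_filter.1 hv).2]
      · rw [hx2 v hv]; ring
    rw [h1, ← one_mul (c i (w i)), ← hy1, Finset.sum_mul]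
    refine Finset.sum_le_sum fun v _ => ?_
    by_cases hv : v ∈ φ i
    · exact mul_le_mul_of_nonneg_left (hwmax i v hv) (hy0 v)
    · rw [hy2 v hv]; simp
  · rintro ⟨hx, hmax⟩
    refine mem_prodCell.2 fun i => ?_
    obtain ⟨h0, h1, h2⟩ := mem_prodCell.1 hx i
    refine ⟨h0, h1, fun v hv => ?_⟩
    by_cases hvφ : v ∈ φ i
    swap
    · exact h2 v hvφ
    by_contra hne
    have hpos : 0 < x i v := lt_of_le_of_ne (h0 v) (Ne.symm hne)
    have hlt : c i v < c i (w i) :=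
      lt_of_le_of_ne (hwmax i v hvφ) fun heq => hv (Finset.mem_filter.2 ⟨hvφ, heq⟩)
    have hwv : w i ≠ v := fun heq => by rw [heq] at hlt; exact lt_irrefl _ hlt
    let y : Fin d → V → ℝ := x + x i v • e i (w i) - x i v • e i v
    have hyj : ∀ j, j ≠ i → y j = x j := by
      intro j hj
      simp [y, e, Pi.single_eq_of_ne hj]
    have hyi : ∀ u, y i u = x i u + x i v * (Pi.single (w i) (1 : ℝ) : V → ℝ) u
        - x i v * (Pi.single v (1 : ℝ) : V → ℝ) u := by
      intro u; simp [y, e]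
    have hy : y ∈ prodCell φ := mem_prodCell.2 fun j => by
      by_cases hj : j = i
      · subst hj
        refine ⟨fun u => ?_, ?_, fun u hu => ?_⟩
        · rw [hyi]
          by_cases huv : u = v
          · subst huv
            simp [Pi.single_eq_of_ne hwv.symm]
          · rw [Pi.single_eq_of_ne huv, Pi.single_apply]
            split_ifs
            · linarith [h0 u]
            · linarith [h0 u]
        · simp only [hyi, Finset.sum_sub_distrib, Finset.sum_add_distrib, ← Finset.mul_sum, h1]
          simp
        · rw [hyi, h2 u hu, Pi.single_eq_of_ne (fun h : u = w j => hu (h ▸ hw j)),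
            Pi.single_eq_of_ne (fun h : u = v => hu (h ▸ hvφ))]
          ring
      · rw [hyj j hj]
        exact mem_prodCell.1 hx j
    have := hmax y hy
    have hly : l y = l x + x i v * (c i (w i) - c i v) := by
      simp only [y, map_sub, map_add, map_smul, smul_eq_mul, c]
      ring
    rw [hly] at this
    nlinarith [mul_pos hpos (sub_pos.2 hlt)]

/-! ### The complex `X_H` -/

namespace DGraph

variable {d : ℕ}

/-- The cells `σ₁ × ⋯ × σ_d` of `X_H`: tuples of nonempty vertex sets with `σ₁ < ⋯ < σ_d`, all of
whose vertices `v₁ × ⋯ × v_d` are edges of `H`. -/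
def IsCell (H : DGraph d) (φ : Fin d → Finset H.verts) : Prop :=
  (∀ i, (φ i).Nonempty) ∧
  (∀ i j, i < j → ∀ s ∈ φ i, ∀ t ∈ φ j, s < t) ∧
  ∀ v : Fin d → H.verts, (∀ i, v i ∈ φ i) → Finset.univ.image (fun i => (v i : ℤ)) ∈ H.edges

open Classical in
/-- The polyhedral complex `X_H`, a subcomplex of the product of `d` copies of the simplex
on the vertices of `H`. -/
noncomputable def polyhedralComplex (H : DGraph d) : PolyhedralComplex (Fin d → H.verts → ℝ) where
  Face := {φ : Fin d → Finset H.verts // H.IsCell φ}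
  carrier := fun φ => prodCell φ.1
  carrier_injective := fun φ ψ h => Subtype.ext (prodCell_injective φ.2.1 ψ.2.1 h)
  polytope := fun φ => prodCell_polytope φ.2.1
  face_mem := by
    intro φ B hB h
    obtain ⟨ψ, hψ, hψB⟩ := prodCell_face φ.2.1 hB h
    exact ⟨⟨ψ, fun i => (hψ i).1,
      fun i j hij s hs t ht => φ.2.2.1 i j hij s ((hψ i).2 hs) t ((hψ j).2 ht),
      fun v hv => φ.2.2.2 v fun i => (hψ i).2 (hv i)⟩, hψB⟩
  inter_exposed := fun φ ψ => prodCell_inter φ.1 ψ.1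

/-- The labeled complex `X_H`: the vertex `v₁ × ⋯ × v_d` is labeled by `x_{v₁} ⋯ x_{v_d}`. -/
noncomputable def labeledComplex (H : DGraph d) :
    LabeledPolyhedralComplex (Fin d → H.verts → ℝ) H.verts where
  toPolyhedralComplex := H.polyhedralComplex
  vertexLabel := fun φ => ∑ i : Fin d, ∑ v ∈ φ.1.1 i, Finsupp.single v 1

/-- The squarefree degree in `ℤ^{V(H)}` given by a set `α` of vertices. -/
def squarefreeDegree (H : DGraph d) (α : Finset ℤ) : H.verts → ℤ :=
  fun v => if (v : ℤ) ∈ α then 1 else 0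

end DGraph

/-!
A cell `σ₁ × ⋯ × σ_d` of `X_H` has dimension `∑ |σᵢ| - d`, and its label is the squarefree monomial
of `⋃ σᵢ`, a disjoint union (`DGraph.dim_add`, `DGraph.label_apply`).  Hence a face and its facets
have different labels, which gives minimality, and the degree of a label determines the dimension.

Exactness is tested in each degree `α` of the `ℤ^{V(H)}`-grading
(`GradedMatrix.exact_iff_strandExact`), where it concerns the cells with vertices in
`W = {v | 1 ≤ α v}`.  Let `b` be the lexicographically smallest edge in `W`.  Given a cell `σ`, let
`i` be the first index with `σᵢ ≠ {bᵢ}`, and add `bᵢ` to `σᵢ` or remove it from `σᵢ`.  The result is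
again a cell: by minimality `bᵢ` does not exceed any element of `σᵢ`, and in a cointerval graph an
element of an edge, other than the last, may be replaced by a smaller vertex that still exceeds the
preceding element (`DGraph.IsCointerval.exchange`, `DGraph.IsLexMinEdge.isCell_update`).  This
matches all cells, the vertex `b` being matched with the empty face, and the matching is acyclic
since the index `i` is monotone along it (`DGraph.admitsMatching`).  An acyclic matching forces
exactness whenever the incidence numbers of facets are units and `∂² = 0`
(`GradedMatrix.strandExact_of_matching`), so that no comparison between orientations is needed.  An
orientation exists since `σ ↦ ⋃ σᵢ` allows to use the signs of the simplex on `V(H)`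
(`DGraph.nonempty_orientation`).

Betti numbers do not depend on the minimal resolution (`GradedFreeSequence.rank_eq_rank`): the
comparison maps between two minimal resolutions are inverse to each other up to homotopy, and, by
minimality, a homotopy does not contribute to the blocks of the matrices in which source and target
have the same degree.
-/

/-! ### Graded matrices and their strands -/

namespace GradedMatrix

open MvPolynomial

variable {k : Type*} [Field k] {σ : Type*} [Fintype σ]

/-- The exponent vector `α - β`, for `β ≤ α` in `ℤ^σ` (negative entries are truncated to `0`). -/
noncomputable def expSub (α β : σ → ℤ) : σ →₀ ℕ :=
  Finsupp.equivFunOnFinite.symm fun v => (α v - β v).toNat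

theorem expSub_apply (α β : σ → ℤ) (v : σ) : expSub α β v = (α v - β v).toNat := rfl

theorem expSub_self (α : σ → ℤ) : expSub α α = 0 := by
  ext v; simp [expSub_apply]

theorem expSub_le_expSub_iff {α β γ : σ → ℤ} (hβ : γ ≤ β) (hα : γ ≤ α) :
    expSub β γ ≤ expSub α γ ↔ β ≤ α := by
  constructor
  · intro h v
    have h1 := h v
    have h2 : γ v ≤ β v := hβ v
    have h3 : γ v ≤ α v := hα v
    simp only [expSub_apply] at h1
    change β v ≤ α v
    omega
  · intro h v
    have h1 : β v ≤ α v := h v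
    simp only [expSub_apply]
    omega

theorem expSub_tsub_expSub {α β γ : σ → ℤ} (hβ : γ ≤ β) (hα : β ≤ α) :
    expSub α γ - expSub β γ = expSub α β := by
  ext v
  have h2 : γ v ≤ β v := hβ v
  have h3 : β v ≤ α v := hα v
  simp only [Finsupp.tsub_apply, expSub_apply]
  omega

theorem expSub_add_expSub {α β γ : σ → ℤ} (hβ : γ ≤ β) (hα : β ≤ α) :
    expSub β γ + expSub α β = expSub α γ := by
  ext v
  have h2 : γ v ≤ β v := hβ v
  have h3 : β v ≤ α v := hα v
  simp only [Finsupp.add_apply, expSub_apply]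
  omega

variable {ι κ μ : Type*}

/-- A matrix of polynomials describes a homomorphism of degree zero from `⨁_b S(-degκ b)` to
`⨁_a S(-degι a)`. -/
def IsGraded (A : Matrix ι κ (MvPolynomial σ k)) (degι : ι → σ → ℤ) (degκ : κ → σ → ℤ) : Prop :=
  ∀ a b, ∀ m ∈ (A a b).support, ∀ v, (m v : ℤ) = degκ b v - degι a v

/-- The matrix of scalars of a graded matrix, whose entries are scalar multiples of
monomials. -/
noncomputable def coef (A : Matrix ι κ (MvPolynomial σ k)) (degι : ι → σ → ℤ)
    (degκ : κ → σ → ℤ) : Matrix ι κ k :=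
  Matrix.of fun a b => coeff (expSub (degκ b) (degι a)) (A a b)

/-- A vector, regarded as an element of the free module `⨁_a k` filtered by `deg`, lies in the step
`α` of the filtration. -/
def IsSupported {P : Type*} [LE P] (deg : κ → P) (α : P) (z : κ → k) : Prop :=
  ∀ a, z a ≠ 0 → deg a ≤ α

/-- A matrix of scalars respects the filtrations by degrees. -/
def IsFiltered {P : Type*} [LE P] (A : Matrix ι κ k) (degι : ι → P) (degκ : κ → P) : Prop :=
  ∀ a b, A a b ≠ 0 → degι a ≤ degκ b

/-- The pair of filtered maps `k^μ → k^κ → k^ι` is exact in each step of the filtration. -/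
def StrandExact {P : Type*} [LE P] [Fintype κ] [Fintype μ] (A : Matrix ι κ k) (B : Matrix κ μ k)
    (degκ : κ → P) (degμ : μ → P) : Prop :=
  A * B = 0 ∧ ∀ α z, IsSupported degκ α z → A.mulVec z = 0 →
    ∃ w, IsSupported degμ α w ∧ B.mulVec w = z

theorem IsFiltered.isSupported_mulVec {P : Type*} [Preorder P] [Fintype κ] {A : Matrix ι κ k}
    {degι : ι → P} {degκ : κ → P} (hA : IsFiltered A degι degκ) {α : P} {z : κ → k}
    (hz : IsSupported degκ α z) : IsSupported degι α (A.mulVec z) := by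
  intro a ha
  obtain ⟨b, -, hb⟩ := Finset.exists_ne_zero_of_sum_ne_zero ha
  exact (hA a b (left_ne_zero_of_mul hb)).trans (hz b (right_ne_zero_of_mul hb))

theorem IsGraded.apply_eq {A : Matrix ι κ (MvPolynomial σ k)} {degι : ι → σ → ℤ}
    {degκ : κ → σ → ℤ} (hA : IsGraded A degι degκ) (a : ι) (b : κ) :
    A a b = monomial (expSub (degκ b) (degι a)) (coef A degι degκ a b) := by
  classical
  ext m
  rw [coeff_monomial]
  split_ifs with h
  · rw [← h]; rfl
  · by_contra hm
    apply h
    ext v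
    have := hA a b m (mem_support_iff.2 hm) v
    rw [expSub_apply]
    omega

theorem IsGraded.isFiltered_coef {A : Matrix ι κ (MvPolynomial σ k)} {degι : ι → σ → ℤ}
    {degκ : κ → σ → ℤ} (hA : IsGraded A degι degκ) :
    IsFiltered (coef A degι degκ) degι degκ := by
  intro a b hab v
  have := hA a b _ (mem_support_iff.2 hab) v
  change degι a v ≤ degκ b v
  omega

open Classical in
/-- The component in degree `α` of an element of `⨁_a S(-deg a)`. -/
noncomputable def strand (deg : κ → σ → ℤ) (α : σ → ℤ) (W : κ → MvPolynomial σ k) : κ → k :=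
  fun a => if deg a ≤ α then coeff (expSub α (deg a)) (W a) else 0

/-- The homogeneous element of degree `α` of `⨁_a S(-deg a)` with given scalars. -/
noncomputable def unstrand (deg : κ → σ → ℤ) (α : σ → ℤ) (z : κ → k) : κ → MvPolynomial σ k :=
  fun a => monomial (expSub α (deg a)) (z a)

theorem isSupported_strand (deg : κ → σ → ℤ) (α : σ → ℤ) (W : κ → MvPolynomial σ k) :
    IsSupported deg α (strand deg α W) := by
  intro a ha
  by_contra h
  exact ha (if_neg h)

theorem strand_unstrand {deg : κ → σ → ℤ} {α : σ → ℤ} {z : κ → k} (hz : IsSupported deg α z) :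
    strand deg α (unstrand deg α z) = z := by
  classical
  funext a
  simp only [strand, unstrand]
  split_ifs with h
  · rw [coeff_monomial, if_pos rfl]
  · by_contra h'
    exact h (hz a (Ne.symm h'))

theorem strand_mulVec [Fintype κ] {A : Matrix ι κ (MvPolynomial σ k)} {degι : ι → σ → ℤ}
    {degκ : κ → σ → ℤ} (hA : IsGraded A degι degκ) (α : σ → ℤ) (W : κ → MvPolynomial σ k) :
    strand degι α (A.mulVec W) = (coef A degι degκ).mulVec (strand degκ α W) := by
  funext a
  simp only [Matrix.mulVec, dotProduct]
  by_cases ha : degι a ≤ α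
  · simp only [strand, if_pos ha]
    change coeff _ (∑ b, A a b * W b) = _
    rw [MvPolynomial.coeff_sum]
    refine Finset.sum_congr rfl fun b _ => ?_
    rw [hA.apply_eq a b, coeff_monomial_mul']
    by_cases hc : coef A degι degκ a b = 0
    · simp [hc]
    · have hab := hA.isFiltered_coef a b hc
      by_cases hb : degκ b ≤ α
      · rw [if_pos ((expSub_le_expSub_iff hab ha).2 hb), if_pos hb, expSub_tsub_expSub hab hb]
      · rw [if_neg (fun h => hb ((expSub_le_expSub_iff hab ha).1 h)), if_neg hb, mul_zero]
  · simp only [strand, if_neg ha]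
    refine (Finset.sum_eq_zero fun b _ => ?_).symm
    by_cases hc : coef A degι degκ a b = 0
    · simp [hc]
    · rw [if_neg (fun h => ha ((hA.isFiltered_coef a b hc).trans h)), mul_zero]

theorem mulVec_unstrand [Fintype κ] {A : Matrix ι κ (MvPolynomial σ k)} {degι : ι → σ → ℤ}
    {degκ : κ → σ → ℤ} (hA : IsGraded A degι degκ) {α : σ → ℤ} {z : κ → k}
    (hz : IsSupported degκ α z) :
    A.mulVec (unstrand degκ α z) = unstrand degι α ((coef A degι degκ).mulVec z) := by
  funext a
  simp only [Matrix.mulVec, dotProduct, unstrand, map_sum]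
  refine Finset.sum_congr rfl fun b _ => ?_
  rw [hA.apply_eq a b, monomial_mul]
  by_cases hc : coef A degι degκ a b * z b = 0
  · simp [hc]
  · rw [expSub_add_expSub (hA.isFiltered_coef a b (left_ne_zero_of_mul hc))
      (hz b (right_ne_zero_of_mul hc))]

/-- An element of a graded free module is the sum of its homogeneous components. -/
theorem exists_eq_sum_unstrand_strand [Fintype κ] (deg : κ → σ → ℤ) (W : κ → MvPolynomial σ k) :
    ∃ T : Finset (σ → ℤ), W = ∑ α ∈ T, unstrand deg α (strand deg α W) := by
  classical
  refine ⟨Finset.univ.biUnion fun a => (W a).support.image fun m v => deg a v + m v, ?_⟩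
  funext a
  ext m
  rw [Finset.sum_apply, coeff_sum]
  have hexp : expSub (fun v => deg a v + (m v : ℤ)) (deg a) = m := by
    ext v; simp [expSub_apply]
  rw [Finset.sum_eq_single (fun v => deg a v + (m v : ℤ))]
  · simp only [unstrand, strand, hexp, coeff_monomial, if_true]
    rw [if_pos]
    intro v
    simp
  · intro α _ hα
    simp only [unstrand, strand, coeff_monomial]
    split_ifs with h1 h2
    · refine absurd (funext fun v => ?_) hα
      have h3 : deg a v ≤ α v := h2 v
      rw [← h1, expSub_apply]
      omega
    · rfl
    · rfl
  · intro hm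
    simp only [unstrand, strand, hexp, coeff_monomial, if_true]
    split_ifs
    · by_contra h
      refine hm (Finset.mem_biUnion.2 ⟨a, Finset.mem_univ a, Finset.mem_image.2 ⟨m, ?_, rfl⟩⟩)
      exact mem_support_iff.2 h
    · rfl

theorem eq_zero_of_strand_eq_zero [Fintype κ] {deg : κ → σ → ℤ} {W : κ → MvPolynomial σ k}
    (h : ∀ α, strand deg α W = 0) : W = 0 := by
  obtain ⟨T, hT⟩ := exists_eq_sum_unstrand_strand deg W
  rw [hT]
  refine Finset.sum_eq_zero fun α _ => ?_
  rw [h α]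
  funext a
  simp [unstrand]

open Classical in
theorem strand_single_one (deg : κ → σ → ℤ) (b : κ) :
    strand deg (deg b) (Pi.single b (1 : MvPolynomial σ k)) = Pi.single b 1 := by
  funext a
  by_cases h : a = b
  · subst h
    simp [strand, expSub_self]
  · simp [strand, Pi.single_eq_of_ne h]

/-- Exactness over the polynomial ring can be tested degree by degree. -/
theorem exact_iff_strandExact [Fintype κ] [Fintype μ] [Fintype ι]
    {A : Matrix ι κ (MvPolynomial σ k)}
    {B : Matrix κ μ (MvPolynomial σ k)} {degι : ι → σ → ℤ} {degκ : κ → σ → ℤ} {degμ : μ → σ → ℤ}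
    (hA : IsGraded A degι degκ) (hB : IsGraded B degκ degμ) :
    Function.Exact B.mulVecLin A.mulVecLin ↔
      StrandExact (coef A degι degκ) (coef B degκ degμ) degκ degμ := by
  classical
  constructor
  · intro h
    refine ⟨?_, fun α z hz hAz => ?_⟩
    · ext a c
      have h1 : A.mulVec (B.mulVec (Pi.single c 1)) = 0 := h.apply_apply_eq_zero (Pi.single c 1)
      have h2 := strand_mulVec hA (degμ c) (B.mulVec (Pi.single c 1))
      rw [h1, strand_mulVec hB, strand_single_one, Matrix.mulVec_mulVec] at h2
      have h3 := congrFun h2 a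
      simpa [strand] using h3.symm
    · obtain ⟨W, hW⟩ := (h (unstrand degκ α z)).1 (by
        change A.mulVec _ = 0
        rw [mulVec_unstrand hA hz, hAz]
        funext a
        simp [unstrand])
      refine ⟨strand degμ α W, isSupported_strand _ _ _, ?_⟩
      rw [← strand_mulVec hB, ← strand_unstrand hz, ← hW]
      rfl
  · rintro ⟨hAB, h⟩ W
    constructor
    · intro hW
      change A.mulVec W = 0 at hW
      have hcyc : ∀ α, (coef A degι degκ).mulVec (strand degκ α W) = 0 := by
        intro α
        rw [← strand_mulVec hA, hW]
        funext a
        simp [strand]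
      choose u hu huW using fun α => h α _ (isSupported_strand degκ α W) (hcyc α)
      obtain ⟨T, hT⟩ := exists_eq_sum_unstrand_strand degκ W
      refine ⟨∑ α ∈ T, unstrand degμ α (u α), ?_⟩
      rw [map_sum]
      conv_rhs => rw [hT]
      refine Finset.sum_congr rfl fun α _ => ?_
      rw [← huW α, ← mulVec_unstrand hB (hu α)]
      rfl
    · rintro ⟨U, rfl⟩
      refine eq_zero_of_strand_eq_zero (deg := degι) fun α => ?_
      change strand degι α (A.mulVec (B.mulVec U)) = 0
      rw [strand_mulVec hA, strand_mulVec hB, Matrix.mulVec_mulVec, hAB, Matrix.zero_mulVec]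

end GradedMatrix

/-! ### Comparison of minimal resolutions -/

namespace GradedMatrix

open MvPolynomial

variable {k : Type*} [Field k] {ι κ μ ν : Type*} {P : Type*}

theorem IsFiltered.mul [Preorder P] [Fintype κ] {A : Matrix ι κ k} {B : Matrix κ μ k} {degι : ι → P}
    {degκ : κ → P} {degμ : μ → P} (hA : IsFiltered A degι degκ) (hB : IsFiltered B degκ degμ) :
    IsFiltered (A * B) degι degμ := by
  intro a c h
  obtain ⟨b, -, hb⟩ := Finset.exists_ne_zero_of_sum_ne_zero h
  exact (hA a b (left_ne_zero_of_mul hb)).trans (hB b c (right_ne_zero_of_mul hb))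

theorem IsFiltered.sub [LE P] {A B : Matrix ι κ k} {degι : ι → P} {degκ : κ → P}
    (hA : IsFiltered A degι degκ) (hB : IsFiltered B degι degκ) :
    IsFiltered (A - B) degι degκ := by
  intro a c h
  by_contra hle
  refine h ?_
  rw [Matrix.sub_apply, not_not.1 (mt (hA a c) hle), not_not.1 (mt (hB a c) hle), sub_zero]

theorem isFiltered_one [Preorder P] [DecidableEq ι] (degι : ι → P) :
    IsFiltered (1 : Matrix ι ι k) degι degι := by
  intro a b h
  by_cases hab : a = b
  · rw [hab]
  · exact absurd (Matrix.one_apply_ne hab) h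

/-- Exactness lifts filtered maps out of a free module along `B`. -/
theorem StrandExact.exists_lift [LE P] [Fintype κ] [Fintype μ] {A : Matrix ι κ k}
    {B : Matrix κ μ k} {degκ : κ → P} {degμ : μ → P} (h : StrandExact A B degκ degμ)
    {degν : ν → P} {C : Matrix κ ν k} (hC : IsFiltered C degκ degν) (hAC : A * C = 0) :
    ∃ C' : Matrix μ ν k, IsFiltered C' degμ degν ∧ B * C' = C := by
  choose w hw hBw using fun c => h.2 (degν c) (fun a => C a c) (fun a ha => hC a c ha) (by
    funext i
    exact congrFun (congrFun hAC i) c)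
  refine ⟨Matrix.of fun b c => w c b, fun b c hbc => hw c b hbc, ?_⟩
  ext a c
  exact congrFun (hBw c) a

/-- The product of a filtered matrix with vanishing diagonal blocks and a filtered matrix has
vanishing diagonal blocks. -/
theorem mul_apply_eq_zero_left [PartialOrder P] [Fintype κ] {A : Matrix ι κ k} {B : Matrix κ μ k}
    {degι : ι → P} {degκ : κ → P} {degμ : μ → P} (hA : IsFiltered A degι degκ)
    (hB : IsFiltered B degκ degμ) (hmin : ∀ a b, degι a = degκ b → A a b = 0) {a : ι} {c : μ}
    (h : degι a = degμ c) : (A * B) a c = 0 := by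
  refine Finset.sum_eq_zero fun b _ => ?_
  by_contra hne
  have h1 := hA a b (left_ne_zero_of_mul hne)
  have h2 := hB b c (right_ne_zero_of_mul hne)
  exact left_ne_zero_of_mul hne (hmin a b (h1.antisymm (h ▸ h2)))

/-- The product of a filtered matrix and a filtered matrix with vanishing diagonal blocks has
vanishing diagonal blocks. -/
theorem mul_apply_eq_zero_right [PartialOrder P] [Fintype κ] {A : Matrix ι κ k} {B : Matrix κ μ k}
    {degι : ι → P} {degκ : κ → P} {degμ : μ → P} (hA : IsFiltered A degι degκ)
    (hB : IsFiltered B degκ degμ) (hmin : ∀ b c, degκ b = degμ c → B b c = 0) {a : ι} {c : μ}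
    (h : degι a = degμ c) : (A * B) a c = 0 := by
  refine Finset.sum_eq_zero fun b _ => ?_
  by_contra hne
  have h1 := hA a b (left_ne_zero_of_mul hne)
  have h2 := hB b c (right_ne_zero_of_mul hne)
  exact right_ne_zero_of_mul hne (hmin b c (h2.antisymm (h ▸ h1)))

open Classical in
theorem submatrix_mul_submatrix_eq_one [PartialOrder P] [Fintype κ]
    {A : Matrix ι κ k} {B : Matrix κ ι k} {degι : ι → P} {degκ : κ → P}
    (hA : IsFiltered A degι degκ) (hB : IsFiltered B degκ degι)
    (h : ∀ a b, degι a = degι b → (A * B - 1 : Matrix ι ι k) a b = 0) (α : P) :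
    A.submatrix (Subtype.val : {a // degι a = α} → ι) (Subtype.val : {b // degκ b = α} → κ) *
      B.submatrix (Subtype.val : {b // degκ b = α} → κ)
        (Subtype.val : {a // degι a = α} → ι) = 1 := by
  ext a c
  have h1 := h a.1 c.1 (a.2.trans c.2.symm)
  rw [Matrix.sub_apply, sub_eq_zero] at h1
  have h2 : (1 : Matrix ι ι k) a.1 c.1 = (1 : Matrix {a // degι a = α} _ k) a c := by
    simp [Matrix.one_apply, Subtype.ext_iff]
  rw [← h2, ← h1, Matrix.mul_apply, Matrix.mul_apply]
  simp only [Matrix.submatrix_apply]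
  rw [← Finset.sum_subtype (Finset.univ.filter fun b => degκ b = α) (by simp)
    (fun b => A a.1 b * B b c.1)]
  refine Finset.sum_subset (Finset.subset_univ _) fun b _ hb => ?_
  by_contra hne
  have h3 := hA a b (left_ne_zero_of_mul hne)
  have h4 := hB b c (right_ne_zero_of_mul hne)
  rw [a.2] at h3
  rw [c.2] at h4
  exact hb (Finset.mem_filter.2 ⟨Finset.mem_univ _, h4.antisymm h3⟩)

open Classical in
/-- If the diagonal blocks of `A * B` and `B * A` are identity matrices, for filtered matrices `A`
and `B`, then both sides have equally many basis elements in each degree. -/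
theorem card_eq_of_diagonal_blocks [PartialOrder P] [Fintype ι] [Fintype κ] {A : Matrix ι κ k}
    {B : Matrix κ ι k} {degι : ι → P} {degκ : κ → P} (hA : IsFiltered A degι degκ)
    (hB : IsFiltered B degκ degι)
    (hAB : ∀ a b, degι a = degι b → (A * B - 1 : Matrix ι ι k) a b = 0)
    (hBA : ∀ a b, degκ a = degκ b → (B * A - 1 : Matrix κ κ k) a b = 0) (α : P) :
    Nat.card {a // degι a = α} = Nat.card {b // degκ b = α} := by
  rw [Nat.card_eq_fintype_card, Nat.card_eq_fintype_card]
  exact Matrix.square_of_invertible _ _ (submatrix_mul_submatrix_eq_one hA hB hAB α)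
    (submatrix_mul_submatrix_eq_one hB hA hBA α)

end GradedMatrix

namespace GradedFreeSequence

open MvPolynomial GradedMatrix

variable {k : Type*} [Field k] {σ : Type*}

/-- The augmentation `F 0 → S` as a matrix with one row. -/
noncomputable def augMatrix (F : GradedFreeSequence k σ) :
    Matrix Unit (F.gen 0) (MvPolynomial σ k) :=
  Matrix.of fun _ a => F.aug a

theorem isGraded_augMatrix (F : GradedFreeSequence k σ) :
    IsGraded F.augMatrix (fun _ => 0) (F.deg 0) := by
  intro a b m hm v
  rw [F.aug_homogeneous b m hm v]
  simp

theorem augMatrix_mulVec (F : GradedFreeSequence k σ) (W : F.gen 0 → MvPolynomial σ k) :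
    F.augMatrix.mulVec W = fun _ => Fintype.linearCombination (MvPolynomial σ k) F.aug W := by
  funext _
  rw [Fintype.linearCombination_apply]
  exact Finset.sum_congr rfl fun a _ => mul_comm _ _

variable [Fintype σ]

/-- The scalars of the differential `F (i+1) → F i`. -/
noncomputable def diffCoef (F : GradedFreeSequence k σ) (i : ℕ) :
    Matrix (F.gen i) (F.gen (i + 1)) k :=
  coef (F.diff i) (F.deg i) (F.deg (i + 1))

/-- The scalars of the augmentation `F 0 → S`. -/
noncomputable def augCoef (F : GradedFreeSequence k σ) : Matrix Unit (F.gen 0) k :=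
  coef F.augMatrix (fun _ => 0) (F.deg 0)

theorem exact_aug_iff (F : GradedFreeSequence k σ) :
    Function.Exact (F.diff 0).mulVecLin (Fintype.linearCombination (MvPolynomial σ k) F.aug) ↔
      StrandExact F.augCoef (F.diffCoef 0) (F.deg 0) (F.deg 1) := by
  rw [augCoef, diffCoef,
    ← exact_iff_strandExact F.isGraded_augMatrix (F.diff_homogeneous 0)]
  refine forall_congr' fun W => ?_
  refine iff_congr ?_ Iff.rfl
  rw [Matrix.mulVecLin_apply, augMatrix_mulVec]
  exact ⟨fun h => funext fun _ => h, fun h => congrFun h ()⟩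

theorem exact_diff_iff (F : GradedFreeSequence k σ) (i : ℕ) :
    Function.Exact (F.diff (i + 1)).mulVecLin (F.diff i).mulVecLin ↔
      StrandExact (F.diffCoef i) (F.diffCoef (i + 1)) (F.deg (i + 1)) (F.deg (i + 2)) :=
  exact_iff_strandExact (F.diff_homogeneous i) (F.diff_homogeneous (i + 1))

theorem isFiltered_diffCoef (F : GradedFreeSequence k σ) (i : ℕ) :
    IsFiltered (F.diffCoef i) (F.deg i) (F.deg (i + 1)) :=
  IsGraded.isFiltered_coef (F.diff_homogeneous i)

theorem IsMinimal.diffCoef_eq_zero {F : GradedFreeSequence k σ} (hF : F.IsMinimal) (i : ℕ)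
    (a : F.gen i) (b : F.gen (i + 1)) (h : F.deg i a = F.deg (i + 1) b) :
    F.diffCoef i a b = 0 := by
  have hle : Ideal.span (Set.range (X : σ → MvPolynomial σ k)) ≤
      RingHom.ker (constantCoeff : MvPolynomial σ k →+* k) := by
    rw [Ideal.span_le]
    rintro _ ⟨v, rfl⟩
    simp
  have h0 := hle (hF i a b)
  rw [RingHom.mem_ker, constantCoeff_eq] at h0
  rw [diffCoef, coef, Matrix.of_apply, h, expSub_self]
  exact h0

/-- The identity of `I` lifts to the first term of a comparison map. -/
theorem exists_augCoef_mul_eq {F G : GradedFreeSequence k σ}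
    (h : LinearMap.range (Fintype.linearCombination (MvPolynomial σ k) F.aug) ≤
      LinearMap.range (Fintype.linearCombination (MvPolynomial σ k) G.aug)) :
    ∃ φ : Matrix (G.gen 0) (F.gen 0) k, IsFiltered φ (G.deg 0) (F.deg 0) ∧
      G.augCoef * φ = F.augCoef := by
  classical
  choose W hW using fun b : F.gen 0 => h ⟨Pi.single b 1, rfl⟩
  refine ⟨Matrix.of fun a b => strand (G.deg 0) (F.deg 0 b) (W b) a,
    fun a b hab => isSupported_strand _ _ _ a hab, ?_⟩
  ext u b
  have h1 := strand_mulVec G.isGraded_augMatrix (F.deg 0 b) (W b)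
  have h2 := strand_mulVec F.isGraded_augMatrix (F.deg 0 b) (Pi.single b 1)
  rw [strand_single_one] at h2
  rw [augMatrix_mulVec, hW, ← augMatrix_mulVec, h2] at h1
  have h3 := congrFun h1 u
  rw [Matrix.mulVec_single_one] at h3
  exact h3.symm

/-- The identity of `I` lifts to a comparison map between resolutions of `I`. -/
theorem exists_comparison {F G : GradedFreeSequence k σ} {I : Ideal (MvPolynomial σ k)}
    (hF : F.IsFreeResolution I) (hG : G.IsFreeResolution I) :
    ∃ φ : ∀ i, Matrix (G.gen i) (F.gen i) k, (∀ i, IsFiltered (φ i) (G.deg i) (F.deg i)) ∧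
      G.augCoef * φ 0 = F.augCoef ∧ ∀ i, G.diffCoef i * φ (i + 1) = φ i * F.diffCoef i := by
  obtain ⟨φ₀, hφ₀, hφ₀'⟩ := exists_augCoef_mul_eq (F := F) (G := G) (by
    rw [hF.1, hG.1])
  -- the maps `φ i` are constructed together with the fact that they can be lifted once more
  let T : ℕ → Type _ := fun i => {φ : Matrix (G.gen i) (F.gen i) k //
    IsFiltered φ (G.deg i) (F.deg i) ∧ ∃ ψ : Matrix (G.gen (i + 1)) (F.gen (i + 1)) k,
      IsFiltered ψ (G.deg (i + 1)) (F.deg (i + 1)) ∧ G.diffCoef i * ψ = φ * F.diffCoef i}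
  have hF0 := F.exact_aug_iff.1 hF.2.1
  have hG0 := G.exact_aug_iff.1 hG.2.1
  have hFi := fun i => (F.exact_diff_iff i).1 (hF.2.2 i)
  have hGi := fun i => (G.exact_diff_iff i).1 (hG.2.2 i)
  let t₀ : T 0 := ⟨φ₀, hφ₀, hG0.exists_lift (hφ₀.mul (F.isFiltered_diffCoef 0)) (by
    rw [← Matrix.mul_assoc, hφ₀', hF0.1])⟩
  have step : ∀ i (t : T i), ∃ t' : T (i + 1), G.diffCoef i * t'.1 = t.1 * F.diffCoef i := by
    rintro i ⟨φ, hφ, ψ, hψ, hψφ⟩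
    refine ⟨⟨ψ, hψ, (hGi i).exists_lift (hψ.mul (F.isFiltered_diffCoef (i + 1))) ?_⟩, hψφ⟩
    rw [← Matrix.mul_assoc, hψφ, Matrix.mul_assoc, (hFi i).1, Matrix.mul_zero]
  choose next hnext using step
  let t : ∀ i, T i := fun i => Nat.rec t₀ next i
  exact ⟨fun i => (t i).1, fun i => (t i).2.1, hφ₀', fun i => hnext i (t i)⟩

/-- An endomorphism `η` of a minimal resolution which covers the zero map is homotopic to zero, and
therefore its diagonal blocks vanish. -/
theorem diagonal_block_eq_zero {F : GradedFreeSequence k σ} {I : Ideal (MvPolynomial σ k)}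
    (hF : F.IsFreeResolution I) (hmin : F.IsMinimal) {η : ∀ i, Matrix (F.gen i) (F.gen i) k}
    (hη : ∀ i, IsFiltered (η i) (F.deg i) (F.deg i)) (h0 : F.augCoef * η 0 = 0)
    (hcomm : ∀ i, F.diffCoef i * η (i + 1) = η i * F.diffCoef i) (i : ℕ) (a b : F.gen i)
    (hab : F.deg i a = F.deg i b) : η i a b = 0 := by
  have hF0 := F.exact_aug_iff.1 hF.2.1
  have hFi := fun i => (F.exact_diff_iff i).1 (hF.2.2 i)
  -- `g` is the component `F i → F (i+1)` of the homotopy; the condition on it only involves the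
  -- component `F (i-1) → F i` through its consequence for `F (i+1)`
  have key : ∀ i, ∃ g : Matrix (F.gen (i + 1)) (F.gen i) k,
      IsFiltered g (F.deg (i + 1)) (F.deg i) ∧
      (η i - F.diffCoef i * g) * F.diffCoef i = 0 ∧
      ∀ a b, F.deg i a = F.deg i b → η i a b = 0 := by
    intro i
    induction i with
    | zero =>
      obtain ⟨g, hg, hgη⟩ := hF0.exists_lift (hη 0) h0
      refine ⟨g, hg, by rw [hgη, sub_self, Matrix.zero_mul], fun a b hab => ?_⟩
      rw [← hgη]
      exact mul_apply_eq_zero_left (F.isFiltered_diffCoef 0) hg (hmin.diffCoef_eq_zero 0) hab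
    | succ i ih =>
      obtain ⟨g, hg, hgη, -⟩ := ih
      have hgd := hg.mul (F.isFiltered_diffCoef i)
      obtain ⟨g', hg', hgη'⟩ := (hFi i).exists_lift ((hη (i + 1)).sub hgd) (by
        rw [Matrix.mul_sub, hcomm, ← Matrix.mul_assoc, ← Matrix.sub_mul, hgη])
      refine ⟨g', hg', ?_, fun a b hab => ?_⟩
      · rw [hgη', sub_sub_cancel, Matrix.mul_assoc, (hFi i).1, Matrix.mul_zero]
      · have h1 : η (i + 1) = F.diffCoef (i + 1) * g' + g * F.diffCoef i := by
          rw [hgη', sub_add_cancel]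
        rw [h1, Matrix.add_apply,
          mul_apply_eq_zero_left (F.isFiltered_diffCoef (i + 1)) hg'
            (hmin.diffCoef_eq_zero (i + 1)) hab,
          mul_apply_eq_zero_right hg (F.isFiltered_diffCoef i) (hmin.diffCoef_eq_zero i) hab,
          add_zero]
  obtain ⟨-, -, -, h⟩ := key i
  exact h a b hab

/-- Two minimal resolutions of `I` have the same number of summands `S(-α)` in each homological
degree. -/
theorem rank_eq_rank {F G : GradedFreeSequence k σ} {I : Ideal (MvPolynomial σ k)}
    (hF : F.IsFreeResolution I) (hFm : F.IsMinimal) (hG : G.IsFreeResolution I)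
    (hGm : G.IsMinimal) (i : ℕ) (α : σ → ℤ) : F.rank i α = G.rank i α := by
  classical
  obtain ⟨φ, hφ, hφ0, hφd⟩ := exists_comparison hF hG
  obtain ⟨ψ, hψ, hψ0, hψd⟩ := exists_comparison hG hF
  refine card_eq_of_diagonal_blocks (hψ i) (hφ i) (fun a b hab => ?_) (fun a b hab => ?_) α
  · refine diagonal_block_eq_zero hF hFm (η := fun i => ψ i * φ i - 1)
      (fun i => ((hψ i).mul (hφ i)).sub (isFiltered_one _)) ?_ (fun i => ?_) i a b hab
    · rw [Matrix.mul_sub, ← Matrix.mul_assoc, hψ0, hφ0, Matrix.mul_one, sub_self]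
    · rw [Matrix.mul_sub, ← Matrix.mul_assoc, hψd, Matrix.mul_assoc, hφd, Matrix.sub_mul,
        Matrix.mul_assoc, Matrix.mul_one, Matrix.one_mul]
  · refine diagonal_block_eq_zero hG hGm (η := fun i => φ i * ψ i - 1)
      (fun i => ((hφ i).mul (hψ i)).sub (isFiltered_one _)) ?_ (fun i => ?_) i a b hab
    · rw [Matrix.mul_sub, ← Matrix.mul_assoc, hφ0, hψ0, Matrix.mul_one, sub_self]
    · rw [Matrix.mul_sub, ← Matrix.mul_assoc, hφd, Matrix.mul_assoc, hψd, Matrix.sub_mul,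
        Matrix.mul_assoc, Matrix.mul_one, Matrix.one_mul]

end GradedFreeSequence

/-! ### Exactness from an acyclic matching -/

namespace GradedMatrix

variable {k : Type*} [Field k] {ι κ μ : Type*} {P : Type*}

/-- Algebraic discrete Morse theory for a complex `k^μ → k^κ → k^ι` all of whose basis elements in
the middle are matched: a lower one `a` with a basis element `b` of `k^μ`, an upper one `b` with a
basis element `a` of `k^ι`.  The index `idx` certifies that the matching is acyclic: triangularity
with respect to it allows to remove first the lower part of a cycle by adding boundaries, and then
shows that a cycle without lower part is zero.  Only the vanishing and non-vanishing of matrix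
entries matters. -/
theorem strandExact_of_matching [Preorder P] [Fintype κ] [Fintype μ] {A : Matrix ι κ k}
    {B : Matrix κ μ k} {degκ : κ → P} {degμ : μ → P} (hB : IsFiltered B degκ degμ)
    (hAB : A * B = 0)
    (hmatch : ∀ α : P, ∃ (lower : κ → Prop) (idx : κ → ℕ),
      (∀ a, degκ a ≤ α → lower a → ∃ b, degμ b ≤ α ∧ B a b ≠ 0 ∧
        ∀ c, degκ c ≤ α → lower c → c ≠ a → B c b ≠ 0 → idx a < idx c) ∧
      (∀ b, degκ b ≤ α → ¬ lower b → ∃ a, A a b ≠ 0 ∧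
        ∀ c, degκ c ≤ α → ¬ lower c → c ≠ b → A a c ≠ 0 → idx c < idx b)) :
    StrandExact A B degκ degμ := by
  classical
  refine ⟨hAB, fun α z hz hAz => ?_⟩
  obtain ⟨lower, idx, hlow, hup⟩ := hmatch α
  -- remove the lower part of `z` in the order of increasing index
  have hremove : ∀ n, ∃ w, IsSupported degμ α w ∧
      ∀ a, lower a → idx a < n → z a = B.mulVec w a := by
    intro n
    induction n with
    | zero => exact ⟨0, fun a ha => absurd rfl ha, fun a _ h => absurd h (Nat.not_lt_zero _)⟩
    | succ n ih =>
      obtain ⟨w, hw, hwz⟩ := ih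
      -- without basis elements of `k^μ` there are no lower elements to remove
      rcases isEmpty_or_nonempty μ with hμ | hμ
      · refine ⟨w, hw, fun c hc _ => ?_⟩
        have hcα : ¬ degκ c ≤ α := fun h => hμ.elim (hlow c h hc).choose
        rw [not_not.1 (mt (hz c) hcα), not_not.1 (mt (hB.isSupported_mulVec hw c) hcα)]
      choose! u hu huB hulow using hlow
      have hBw := hB.isSupported_mulVec hw
      let s : Finset κ := Finset.univ.filter fun a => degκ a ≤ α ∧ lower a ∧ idx a = n
      let r : κ → k := fun a => (z a - B.mulVec w a) / B a (u a)
      refine ⟨w + ∑ a ∈ s, r a • Pi.single (u a) 1, ?_, fun c hc hcn => ?_⟩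
      · intro b hb
        by_contra hbα
        have h1 : w b = 0 := not_not.1 (mt (hw b) hbα)
        rw [Pi.add_apply, h1, zero_add, Finset.sum_apply] at hb
        refine hb (Finset.sum_eq_zero fun a ha => ?_)
        have ha' := (Finset.mem_filter.1 ha).2
        have hne : b ≠ u a := fun h => hbα (h ▸ hu a ha'.1 ha'.2.1)
        simp [Pi.single_eq_of_ne hne]
      · rw [Matrix.mulVec_add, Pi.add_apply, Matrix.mulVec_sum, Finset.sum_apply]
        simp only [Matrix.mulVec_smul, Matrix.mulVec_single_one, Pi.smul_apply, smul_eq_mul,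
          Matrix.col_apply]
        by_cases hcα : degκ c ≤ α
        swap
        · have h1 : z c = 0 := not_not.1 (mt (hz c) hcα)
          have h2 : B.mulVec w c = 0 := not_not.1 (mt (hBw c) hcα)
          rw [h1, h2, zero_add]
          refine (Finset.sum_eq_zero fun a ha => ?_).symm
          have ha' := (Finset.mem_filter.1 ha).2
          have h3 : B c (u a) = 0 := by
            by_contra h
            exact hcα ((hB c _ h).trans (hu a ha'.1 ha'.2.1))
          rw [h3, mul_zero]
        have hother : ∀ a ∈ s, a ≠ c → r a * B c (u a) = 0 := by
          intro a ha hac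
          have ha' := (Finset.mem_filter.1 ha).2
          by_contra h
          have := hulow a ha'.1 ha'.2.1 c hcα hc (Ne.symm hac) (right_ne_zero_of_mul h)
          omega
        by_cases hcs : c ∈ s
        · rw [Finset.sum_eq_single_of_mem c hcs hother, div_mul_cancel₀ _ (huB c hcα hc)]
          ring
        · have hlt : idx c < n := by
            by_contra h
            exact hcs (Finset.mem_filter.2 ⟨Finset.mem_univ _, hcα, hc, by omega⟩)
          rw [Finset.sum_eq_zero fun a ha => hother a ha fun h => hcs (h ▸ ha), add_zero]
          exact hwz c hc hlt
  obtain ⟨w, hw, hwz⟩ := hremove (Finset.univ.sup idx + 1)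
  refine ⟨w, hw, ?_⟩
  -- the remaining cycle has no lower part; its upper part vanishes in the order of increasing index
  set y : κ → k := z - B.mulVec w with hy
  have hyα : IsSupported degκ α y := by
    intro a ha
    by_contra h
    exact ha (by rw [hy, Pi.sub_apply, not_not.1 (mt (hz a) h),
      not_not.1 (mt (hB.isSupported_mulVec hw a) h), sub_zero])
  have hylow : ∀ a, lower a → y a = 0 := fun a ha => by
    rw [hy, Pi.sub_apply, ← hwz a ha (Nat.lt_succ_of_le (Finset.le_sup (Finset.mem_univ a))),
      sub_self]
  have hAy : A.mulVec y = 0 := by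
    rw [hy, Matrix.mulVec_sub, hAz, Matrix.mulVec_mulVec, hAB, Matrix.zero_mulVec, sub_self]
  have hzero : ∀ n b, idx b = n → y b = 0 := by
    intro n
    induction n using Nat.strong_induction_on with
    | _ n ih =>
      intro b hbn
      by_contra hb
      obtain ⟨a, hab, ha⟩ := hup b (hyα b hb) fun h => hb (hylow b h)
      have h1 : ∑ c, A a c * y c = 0 := congrFun hAy a
      rw [Finset.sum_eq_single b] at h1
      · exact (mul_ne_zero hab hb) h1
      · intro c _ hcb
        by_contra hc
        have hyc := right_ne_zero_of_mul hc
        have hlt := ha c (hyα c hyc) (fun h => hyc (hylow c h)) hcb (left_ne_zero_of_mul hc)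
        exact hyc (ih (idx c) (hbn ▸ hlt) c rfl)
      · exact fun h => absurd (Finset.mem_univ b) h
  have : y = 0 := funext fun b => hzero _ b rfl
  exact (sub_eq_zero.1 this).symm

end GradedMatrix

/-! ### Exactness of cellular complexes with an acyclic matching -/

namespace LabeledPolyhedralComplex

open MvPolynomial GradedMatrix

variable {E : Type*} [AddCommGroup E] [Module ℝ E] [TopologicalSpace E] {σ : Type*}

/-- For each degree `α`, the cells whose labels divide `x^α`, together with the empty face, have an
acyclic matching: a lower cell `F` is matched with a cell `G` having it as a facet, an upper cell
with one of its facets, or with the empty face if it is a vertex.  The function `idx` certifies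
acyclicity. -/
def AdmitsMatching (X : LabeledPolyhedralComplex E σ) : Prop :=
  ∀ α : σ → ℤ, ∃ (lower : X.Face → Prop) (idx : X.Face → ℕ),
    (∀ F, (fun v => (X.label F v : ℤ)) ≤ α → lower F →
      ∃ G, (fun v => (X.label G v : ℤ)) ≤ α ∧ X.IsFacet F G ∧
        ∀ K, lower K → K ≠ F → X.IsFacet K G → idx F < idx K) ∧
    (∀ F, (fun v => (X.label F v : ℤ)) ≤ α → ¬ lower F → X.dim F ≠ 0 →
      ∃ G, X.IsFacet G F ∧ ∀ K, ¬ lower K → K ≠ F → X.IsFacet G K → idx K < idx F) ∧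
    ∀ F G, ¬ lower F → ¬ lower G → X.dim F = 0 → X.dim G = 0 → F = G

theorem sign_cast_ne_zero_iff {X : LabeledPolyhedralComplex E σ} {k : Type*} [Field k]
    (o : X.Orientation) (F G : X.Face) :
    ((o.sign F G : ℤ) : k) ≠ 0 ↔ X.IsFacet G F := by
  constructor
  · intro h
    by_contra hn
    rw [o.sign_of_not_isFacet F G hn] at h
    simp at h
  · intro h
    rcases o.sign_of_isFacet F G h with h | h <;> simp [h]

variable [Fintype σ] (X : LabeledPolyhedralComplex E σ) (k : Type*) [Field k] (o : X.Orientation)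

theorem diffCoef_cellularComplex (i : ℕ) (G : {G : X.Face // X.dim G = i})
    (F : {F : X.Face // X.dim F = i + 1}) :
    (X.cellularComplex k o).diffCoef i G F = ((o.sign F.1 G.1 : ℤ) : k) := by
  classical
  have h : expSub (fun v => (X.label F.1 v : ℤ)) (fun v => (X.label G.1 v : ℤ)) =
      X.label F.1 - X.label G.1 := by
    ext v
    rw [expSub_apply, Finsupp.tsub_apply]
    omega
  change coeff (expSub (fun v => (X.label F.1 v : ℤ)) (fun v => (X.label G.1 v : ℤ)))
    (monomial (X.label F.1 - X.label G.1) ((o.sign F.1 G.1 : ℤ) : k)) = _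
  rw [h, coeff_monomial, if_pos rfl]

theorem augCoef_cellularComplex (u : Unit) (F : {F : X.Face // X.dim F = 0}) :
    (X.cellularComplex k o).augCoef u F = 1 := by
  classical
  have h : expSub (fun v => (X.label F.1 v : ℤ)) (fun _ => 0) = X.label F.1 := by
    ext v
    rw [expSub_apply]
    omega
  change coeff (expSub (fun v => (X.label F.1 v : ℤ)) (fun _ => 0))
    (monomial (X.label F.1) (1 : k)) = _
  rw [h, coeff_monomial, if_pos rfl]

theorem diffCoef_ne_zero_iff (i : ℕ) (G : {G : X.Face // X.dim G = i})
    (F : {F : X.Face // X.dim F = i + 1}) :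
    (X.cellularComplex k o).diffCoef i G F ≠ 0 ↔ X.IsFacet G.1 F.1 := by
  rw [diffCoef_cellularComplex, sign_cast_ne_zero_iff]

theorem diffCoef_mul_diffCoef (i : ℕ) :
    (X.cellularComplex k o).diffCoef i * (X.cellularComplex k o).diffCoef (i + 1) = 0 := by
  classical
  ext G F
  rw [Matrix.mul_apply]
  have h1 : ∑ K, (X.cellularComplex k o).diffCoef i G K *
      (X.cellularComplex k o).diffCoef (i + 1) K F =
      ∑ K : {K : X.Face // X.dim K = i + 1}, ((o.sign F.1 K.1 * o.sign K.1 G.1 : ℤ) : k) :=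
    Finset.sum_congr (by congr) fun K _ =>
      (congrArg₂ (· * ·) (X.diffCoef_cellularComplex k o i G K)
        (X.diffCoef_cellularComplex k o (i + 1) K F)).trans (by push_cast; ring)
  rw [h1, ← Finset.sum_subtype (Finset.univ.filter fun K : X.Face => X.dim K = i + 1) (by simp)
    (fun K => ((o.sign F.1 K * o.sign K G.1 : ℤ) : k))]
  rw [Finset.sum_subset (Finset.subset_univ _), ← Int.cast_sum, o.sum_sign_mul_sign]
  · simp
  · intro K _ hK
    have hF := F.2
    have : ¬ X.IsFacet K F.1 := fun h => hK (Finset.mem_filter.2 ⟨Finset.mem_univ _, by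
      have := h.2
      omega⟩)
    rw [o.sign_of_not_isFacet _ _ this, zero_mul, Int.cast_zero]

theorem augCoef_mul_diffCoef :
    (X.cellularComplex k o).augCoef * (X.cellularComplex k o).diffCoef 0 = 0 := by
  classical
  ext u F
  rw [Matrix.mul_apply]
  have h1 : ∑ K, (X.cellularComplex k o).augCoef u K * (X.cellularComplex k o).diffCoef 0 K F =
      ∑ K : {K : X.Face // X.dim K = 0}, ((o.sign F.1 K.1 : ℤ) : k) :=
    Finset.sum_congr (by congr) fun K _ =>
      (congrArg₂ (· * ·) (X.augCoef_cellularComplex k o u K)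
        (X.diffCoef_cellularComplex k o 0 K F)).trans (one_mul _)
  rw [h1, ← Finset.sum_subtype (Finset.univ.filter fun K : X.Face => X.dim K = 0) (by simp)
    (fun K => ((o.sign F.1 K : ℤ) : k))]
  rw [Finset.sum_subset (Finset.subset_univ _), ← Int.cast_sum, o.sum_sign_edge _ F.2]
  · simp
  · intro K _ hK
    have hF := F.2
    have : ¬ X.IsFacet K F.1 := fun h => hK (Finset.mem_filter.2 ⟨Finset.mem_univ _, by
      have := h.2
      omega⟩)
    rw [o.sign_of_not_isFacet _ _ this, Int.cast_zero]

variable {X}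

theorem strandExact_diffCoef (hX : X.AdmitsMatching) (i : ℕ) :
    StrandExact ((X.cellularComplex k o).diffCoef i) ((X.cellularComplex k o).diffCoef (i + 1))
      ((X.cellularComplex k o).deg (i + 1)) ((X.cellularComplex k o).deg (i + 2)) := by
  refine strandExact_of_matching (GradedFreeSequence.isFiltered_diffCoef _ _)
    (diffCoef_mul_diffCoef X k o i) fun α => ?_
  obtain ⟨lower, idx, hlow, hup, -⟩ := hX α
  refine ⟨fun F => lower F.1, fun F => idx F.1, ?_, ?_⟩
  · rintro ⟨F, hFi⟩ hF hFl
    obtain ⟨G, hG, hFG, h⟩ := hlow F hF hFl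
    have hGi : X.dim G = i + 1 + 1 := by rw [hFG.2, hFi]
    exact ⟨⟨G, hGi⟩, hG, (diffCoef_ne_zero_iff X k o (i + 1) ⟨F, hFi⟩ ⟨G, hGi⟩).2 hFG,
      fun K _ hKl hKF hK => h K.1 hKl (fun h => hKF (Subtype.ext h))
        ((diffCoef_ne_zero_iff X k o (i + 1) K ⟨G, hGi⟩).1 hK)⟩
  · rintro ⟨F, hFi⟩ hF hFl
    obtain ⟨G, hGF, h⟩ := hup F hF hFl (by omega)
    have hGi : X.dim G = i := Nat.succ_injective (hGF.2.symm.trans hFi)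
    exact ⟨⟨G, hGi⟩, (diffCoef_ne_zero_iff X k o i ⟨G, hGi⟩ ⟨F, hFi⟩).2 hGF,
      fun K _ hKl hKF hK => h K.1 hKl (fun h => hKF (Subtype.ext h))
        ((diffCoef_ne_zero_iff X k o i ⟨G, hGi⟩ K).1 hK)⟩

theorem strandExact_augCoef (hX : X.AdmitsMatching) :
    StrandExact (X.cellularComplex k o).augCoef ((X.cellularComplex k o).diffCoef 0)
      ((X.cellularComplex k o).deg 0) ((X.cellularComplex k o).deg 1) := by
  refine strandExact_of_matching (GradedFreeSequence.isFiltered_diffCoef _ _)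
    (augCoef_mul_diffCoef X k o) fun α => ?_
  obtain ⟨lower, idx, hlow, -, hbase⟩ := hX α
  refine ⟨fun F => lower F.1, fun F => idx F.1, ?_, ?_⟩
  · rintro ⟨F, hFi⟩ hF hFl
    obtain ⟨G, hG, hFG, h⟩ := hlow F hF hFl
    have hGi : X.dim G = 0 + 1 := by rw [hFG.2, hFi]
    exact ⟨⟨G, hGi⟩, hG, (diffCoef_ne_zero_iff X k o 0 ⟨F, hFi⟩ ⟨G, hGi⟩).2 hFG,
      fun K _ hKl hKF hK => h K.1 hKl (fun h => hKF (Subtype.ext h))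
        ((diffCoef_ne_zero_iff X k o 0 K ⟨G, hGi⟩).1 hK)⟩
  · rintro ⟨F, hFi⟩ hF hFl
    refine ⟨(), ?_, fun K _ hKl hKF _ => ?_⟩
    · rw [X.augCoef_cellularComplex k o () ⟨F, hFi⟩]
      exact one_ne_zero
    · exact absurd (Subtype.ext (hbase K.1 F hKl hFl K.2 hFi)) hKF

end LabeledPolyhedralComplex

/-! ### Dimension and faces of products of simplices -/

theorem finrank_vectorSpan_prodCell {V : Type*} [Fintype V] [DecidableEq V] {d : ℕ}
    {φ : Fin d → Finset V} (hφ : ∀ i, (φ i).Nonempty) :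
    Module.finrank ℝ (vectorSpan ℝ (prodCell φ)) + d = ∑ i, (φ i).card := by
  choose w hw using hφ
  -- a basis of the direction: the differences of the vertices of each factor with a fixed one
  let u : (Σ i, {v // v ∈ (φ i).erase (w i)}) → Fin d → V → ℝ := fun x =>
    Pi.single x.1 (Pi.single x.2.1 1 - Pi.single (w x.1) 1)
  have hu : ∀ (x : Σ i, {v // v ∈ (φ i).erase (w i)}) i v, v ≠ w i →
      u x i v = if x.1 = i ∧ x.2.1 = v then 1 else 0 := by
    rintro ⟨j, v', hv'⟩ i v hv
    by_cases hj : j = i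
    · subst hj
      simp [u, Pi.single_apply, hv, eq_comm]
    · simp [u, hj]
  have hsum : ∀ (g : (Σ i, {v // v ∈ (φ i).erase (w i)}) → ℝ) (x),
      (∑ y, g y • u y) x.1 x.2.1 = g x := by
    intro g x
    rw [Finset.sum_apply, Finset.sum_apply, Finset.sum_eq_single x]
    · simp [hu x x.1 x.2.1 (Finset.ne_of_mem_erase x.2.2)]
    · rintro y - hy
      rw [Pi.smul_apply, Pi.smul_apply, hu y x.1 x.2.1 (Finset.ne_of_mem_erase x.2.2), if_neg]
      · simp
      · rintro ⟨h1, h2⟩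
        obtain ⟨i, v, hv⟩ := x
        obtain ⟨j, v', hv'⟩ := y
        dsimp only at h1 h2
        subst h1 h2
        exact hy rfl
    · simp
  have hli : LinearIndependent ℝ u := by
    rw [Fintype.linearIndependent_iff]
    intro g hg x
    rw [← hsum g x, hg]
    rfl
  have hspan : vectorSpan ℝ (prodCell φ) = Submodule.span ℝ (Set.range u) := by
    apply le_antisymm
    · rw [vectorSpan_def, Submodule.span_le]
      rintro _ ⟨x, hx, y, hy, rfl⟩
      have hxy : x - y = ∑ b, (x b.1 b.2.1 - y b.1 b.2.1) • u b := by
        have key : ∀ i v, v ≠ w i →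
            (x - y) i v = (∑ b, (x b.1 b.2.1 - y b.1 b.2.1) • u b) i v := by
          intro i v hv
          by_cases hvφ : v ∈ φ i
          · exact (hsum (fun b => x b.1 b.2.1 - y b.1 b.2.1)
              ⟨i, v, Finset.mem_erase.2 ⟨hv, hvφ⟩⟩).symm
          · rw [Pi.sub_apply, Pi.sub_apply, (mem_prodCell.1 hx i).2.2 v hvφ,
              (mem_prodCell.1 hy i).2.2 v hvφ, Finset.sum_apply, Finset.sum_apply,
              Finset.sum_eq_zero, sub_zero]
            rintro ⟨j, v', hv'⟩ -
            rw [Pi.smul_apply, Pi.smul_apply, hu _ i v hv, if_neg, smul_zero]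
            rintro ⟨h1, h2⟩
            dsimp only at h1 h2
            subst h1 h2
            exact hvφ (Finset.mem_of_mem_erase hv')
        -- the coordinates at `w i` are determined by the others
        have hzero : ∀ i, ∑ v, (x - y) i v = 0 := by
          intro i
          simp [(mem_prodCell.1 hx i).2.1, (mem_prodCell.1 hy i).2.1]
        have hzero' : ∀ i, ∑ v, (∑ b, (x b.1 b.2.1 - y b.1 b.2.1) • u b) i v = 0 := by
          intro i
          simp only [Finset.sum_apply]
          rw [Finset.sum_comm]
          refine Finset.sum_eq_zero fun b _ => ?_
          simp only [Pi.smul_apply, ← Finset.smul_sum]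
          have : ∑ v, u b i v = 0 := by
            by_cases hb : b.1 = i
            · subst hb
              simp [u]
            · simp [u, Pi.single_eq_of_ne (Ne.symm hb)]
          rw [this, smul_zero]
        funext i v
        by_cases hv : v = w i
        · subst hv
          have h1 := hzero i
          have h2 := hzero' i
          rw [← Finset.add_sum_erase _ _ (Finset.mem_univ (w i))] at h1 h2
          have h3 : ∑ v ∈ Finset.univ.erase (w i), (x - y) i v =
              ∑ v ∈ Finset.univ.erase (w i), (∑ b, (x b.1 b.2.1 - y b.1 b.2.1) • u b) i v :=
            Finset.sum_congr rfl fun v hv => key i v (Finset.ne_of_mem_erase hv)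
          linarith
        · exact key i v hv
      change x - y ∈ _
      rw [hxy]
      exact Submodule.sum_mem _ fun b _ => Submodule.smul_mem _ _ (Submodule.subset_span ⟨b, rfl⟩)
    · rw [Submodule.span_le]
      rintro _ ⟨⟨i, v, hv⟩, rfl⟩
      have h1 := vertex_mem_prodCell hw
      have h2 := vertex_mem_prodCell (φ := φ) (w := Function.update w i v) (by
        intro j
        by_cases hj : j = i
        · subst hj; simpa using Finset.mem_of_mem_erase hv
        · simpa [Function.update_of_ne hj] using hw j)
      have h3 := vsub_mem_vectorSpan ℝ h2 h1
      refine (congrArg (· ∈ vectorSpan ℝ (prodCell φ)) (funext fun j => ?_)).mpr h3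
      rw [vsub_eq_sub, Pi.sub_apply]
      by_cases hj : j = i
      · subst hj
        simp [u]
      · simp [u, Pi.single_eq_of_ne hj, Function.update_of_ne hj]
  rw [hspan, finrank_span_eq_card hli, Fintype.card_sigma]
  simp only [Fintype.card_coe]
  have hcard : ∑ i, (((φ i).erase (w i)).card + 1) = ∑ i, (φ i).card :=
    Finset.sum_congr rfl fun i _ => Finset.card_erase_add_one (hw i)
  rw [← hcard, Finset.sum_add_distrib]
  simp

theorem prodCell_mono {V : Type*} [DecidableEq V] {d : ℕ} {φ ψ : Fin d → Finset V}
    (h : ∀ i, φ i ⊆ ψ i) : prodCell φ ⊆ prodCell ψ :=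
  Set.pi_mono fun i _ => convexHull_mono (Set.image_mono (Finset.coe_subset.2 (h i)))

namespace DGraph

variable {d : ℕ} {H : DGraph d}

theorem dim_add (F : H.polyhedralComplex.Face) :
    H.polyhedralComplex.dim F + d = ∑ i, (F.1 i).card :=
  finrank_vectorSpan_prodCell F.2.1

theorem carrier_subset_iff {G F : H.polyhedralComplex.Face} :
    H.polyhedralComplex.carrier G ⊆ H.polyhedralComplex.carrier F ↔ ∀ i, G.1 i ⊆ F.1 i :=
  ⟨fun h => prodCell_subset G.2.1 h, fun h => prodCell_mono h⟩

theorem isFacet_iff {G F : H.polyhedralComplex.Face} :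
    H.polyhedralComplex.IsFacet G F ↔
      (∀ i, G.1 i ⊆ F.1 i) ∧ ∑ i, (F.1 i).card = ∑ i, (G.1 i).card + 1 := by
  rw [PolyhedralComplex.IsFacet, carrier_subset_iff, ← dim_add, ← dim_add]
  refine and_congr Iff.rfl ?_
  omega

theorem IsCell.mono {φ ψ : Fin d → Finset H.verts} (hφ : H.IsCell φ) (h : ∀ i, ψ i ⊆ φ i)
    (hψ : ∀ i, (ψ i).Nonempty) : H.IsCell ψ :=
  ⟨hψ, fun i j hij s hs t ht => hφ.2.1 i j hij s (h i hs) t (h j ht),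
    fun v hv => hφ.2.2 v fun i => h i (hv i)⟩

/-- The factors of a cell are pairwise disjoint. -/
theorem IsCell.index_unique {φ : Fin d → Finset H.verts} (hφ : H.IsCell φ) {i j : Fin d}
    {v : H.verts} (hi : v ∈ φ i) (hj : v ∈ φ j) : i = j := by
  rcases lt_trichotomy i j with h | h | h
  · exact absurd (hφ.2.1 i j h v hi v hj) (lt_irrefl _)
  · exact h
  · exact absurd (hφ.2.1 j i h v hj v hi) (lt_irrefl _)

theorem eq_of_subset_of_card {V : Type*} {φ ψ : Fin d → Finset V}
    (h : ∀ i, φ i ⊆ ψ i) (hc : ∑ i, (ψ i).card ≤ ∑ i, (φ i).card) : φ = ψ := by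
  have h1 := (Finset.sum_eq_sum_iff_of_le (s := Finset.univ) fun i _ => Finset.card_le_card (h i)).1
    (le_antisymm (Finset.sum_le_sum fun i _ => Finset.card_le_card (h i)) hc)
  exact funext fun i => Finset.eq_of_subset_of_card_le (h i) (h1 i (Finset.mem_univ i)).ge

/-! ### Labels of the faces of `X_H` -/

theorem sum_single_apply (φ : Fin d → Finset H.verts) (v : H.verts) :
    (∑ i : Fin d, ∑ u ∈ φ i, Finsupp.single u 1 : H.verts →₀ ℕ) v =
      (Finset.univ.filter fun i => v ∈ φ i).card := by
  classical
  rw [Finset.card_filter, Finsupp.finsetSum_apply]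
  refine Finset.sum_congr rfl fun i _ => ?_
  rw [Finsupp.finsetSum_apply]
  simp only [Finsupp.single_apply, Finset.sum_ite_eq']

theorem IsCell.card_filter {φ : Fin d → Finset H.verts} (hφ : H.IsCell φ) (v : H.verts) :
    (Finset.univ.filter fun i => v ∈ φ i).card = if ∃ i, v ∈ φ i then 1 else 0 := by
  split_ifs with h
  · obtain ⟨i, hi⟩ := h
    rw [Finset.card_eq_one]
    refine ⟨i, Finset.ext fun j => ?_⟩
    simp only [Finset.mem_filter, Finset.mem_univ, true_and, Finset.mem_singleton]
    exact ⟨fun hj => hφ.index_unique hj hi, fun hj => hj ▸ hi⟩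
  · rw [Finset.card_eq_zero]
    exact Finset.filter_eq_empty_iff.2 fun i _ hi => h ⟨i, hi⟩

theorem label_eq_sum (F : H.labeledComplex.Face) :
    H.labeledComplex.label F = ∑ i : Fin d, ∑ u ∈ F.1 i, Finsupp.single u 1 := by
  classical
  apply le_antisymm
  · refine Finset.sup_le fun G hG => ?_
    have hsub : ∀ i, G.1.1 i ⊆ F.1 i := carrier_subset_iff.1 (Finset.mem_filter.1 hG).2
    change (∑ i : Fin d, ∑ u ∈ G.1.1 i, Finsupp.single u 1 : H.verts →₀ ℕ) ≤ _
    exact Finset.sum_le_sum fun i _ => Finset.sum_le_sum_of_subset (hsub i)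
  · intro v
    rw [sum_single_apply, IsCell.card_filter F.2]
    split_ifs with h
    swap
    · exact Nat.zero_le _
    obtain ⟨i, hi⟩ := h
    choose w hw using F.2.1
    let ψ : Fin d → Finset H.verts := fun j => {Function.update w i v j}
    have hψF : ∀ j, ψ j ⊆ F.1 j := by
      intro j
      rw [Finset.singleton_subset_iff]
      by_cases hj : j = i
      · subst hj; simpa using hi
      · simpa [Function.update_of_ne hj] using hw j
    let G : H.polyhedralComplex.Face :=
      ⟨ψ, IsCell.mono F.2 hψF fun j => Finset.singleton_nonempty _⟩
    have hG : H.polyhedralComplex.dim G = 0 := by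
      have h1 := dim_add G
      have h2 : ∑ j, (G.1 j).card = d := by simp [G, ψ]
      omega
    have hle : H.labeledComplex.vertexLabel ⟨G, hG⟩ ≤ H.labeledComplex.label F :=
      Finset.le_sup (f := H.labeledComplex.vertexLabel)
        (Finset.mem_filter.2 ⟨Finset.mem_univ _, carrier_subset_iff.2 hψF⟩)
    refine le_trans ?_ (hle v)
    change 1 ≤ (∑ j : Fin d, ∑ u ∈ ψ j, Finsupp.single u 1 : H.verts →₀ ℕ) v
    rw [sum_single_apply]
    exact Finset.card_pos.2 ⟨i, Finset.mem_filter.2 ⟨Finset.mem_univ _, by simp [ψ]⟩⟩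

open Classical in
/-- The label of a face is the squarefree monomial given by its set of vertices. -/
theorem label_apply (F : H.labeledComplex.Face) (v : H.verts) :
    H.labeledComplex.label F v = if ∃ i, v ∈ F.1 i then 1 else 0 := by
  rw [label_eq_sum, sum_single_apply, IsCell.card_filter F.2]

/-- The resolution is linear: the dimension of a face and the degree of its label differ
by `d`. -/
theorem dim_add_eq_sum_label (F : H.labeledComplex.Face) :
    H.labeledComplex.dim F + d = ∑ v, H.labeledComplex.label F v := by
  have h : H.labeledComplex.dim F + d = ∑ i, (F.1 i).card := dim_add F
  rw [h, label_eq_sum]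
  simp only [Finsupp.finsetSum_apply]
  rw [Finset.sum_comm]
  refine Finset.sum_congr rfl fun i _ => ?_
  rw [Finset.sum_comm, Finset.card_eq_sum_ones]
  refine Finset.sum_congr rfl fun u _ => ?_
  simp [Finsupp.single_apply]

end DGraph

/-! ### An orientation of `X_H` -/

namespace DGraph

variable {d : ℕ} {H : DGraph d}

/-- The elements of the factors of a cell, each with the index of its factor. -/
def total {V : Type*} (φ : Fin d → Finset V) : Finset (Σ _ : Fin d, V) :=
  Finset.univ.sigma φ

theorem mem_total {V : Type*} {φ : Fin d → Finset V} {x : Σ _ : Fin d, V} :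
    x ∈ total φ ↔ x.2 ∈ φ x.1 := by
  simp [total]

theorem total_injective {V : Type*} : Function.Injective (total (d := d) (V := V)) := by
  intro φ ψ h
  funext i
  ext v
  rw [← mem_total (φ := φ) (x := ⟨i, v⟩), h, mem_total]

theorem isFacet_iff_exists_insert {G F : H.polyhedralComplex.Face} :
    H.polyhedralComplex.IsFacet G F ↔ ∃ x ∉ total G.1, insert x (total G.1) = total F.1 := by
  rw [isFacet_iff, Finset.exists_eq_insert_iff, total, total, Finset.card_sigma,
    Finset.card_sigma, eq_comm]
  refine and_congr ⟨fun h => Finset.sigma_mono (Finset.Subset.refl _) h, fun h i v hv => ?_⟩ Iff.rfl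
  have h1 : (⟨i, v⟩ : Σ _ : Fin d, H.verts) ∈ Finset.univ.sigma F.1 := h (by simpa using hv)
  simpa using h1

theorem snd_ne_snd (F : H.polyhedralComplex.Face) {x y : Σ _ : Fin d, H.verts}
    (hx : x ∈ total F.1) (hy : y ∈ total F.1) (h : x ≠ y) : x.2 ≠ y.2 := by
  intro hxy
  rw [mem_total] at hx hy
  obtain ⟨i, v⟩ := x
  obtain ⟨j, w⟩ := y
  dsimp only at hx hy hxy
  subst hxy
  exact h (by rw [IsCell.index_unique F.2 hx hy])

theorem exists_total_eq_erase (F : H.polyhedralComplex.Face) {x : Σ _ : Fin d, H.verts}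
    (hx : ∃ v ∈ F.1 x.1, v ≠ x.2) :
    ∃ G : H.polyhedralComplex.Face, total G.1 = (total F.1).erase x := by
  classical
  let ψ : Fin d → Finset H.verts := fun i =>
    (F.1 i).filter fun v => (⟨i, v⟩ : Σ _ : Fin d, H.verts) ≠ x
  refine ⟨⟨ψ, IsCell.mono F.2 (fun i => Finset.filter_subset _ _) fun i => ?_⟩, ?_⟩
  · by_cases hi : i = x.1
    · obtain ⟨v, hv, hvx⟩ := hx
      subst hi
      exact ⟨v, Finset.mem_filter.2 ⟨hv, fun h => hvx (by rw [← h])⟩⟩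
    · obtain ⟨v, hv⟩ := F.2.1 i
      exact ⟨v, Finset.mem_filter.2 ⟨hv, fun h => hi (by rw [← h])⟩⟩
  · ext y
    rw [mem_total, Finset.mem_erase, mem_total, Finset.mem_filter, and_comm]

/-- The number of elements of a cell that precede `x`. -/
noncomputable def position (T : Finset (Σ _ : Fin d, H.verts)) (x : Σ _ : Fin d, H.verts) : ℕ :=
  (T.filter fun y => y.2 < x.2).card

theorem position_insert {T : Finset (Σ _ : Fin d, H.verts)} {x y : Σ _ : Fin d, H.verts}
    (hy : y ∉ T) : position (insert y T) x = position T x + if y.2 < x.2 then 1 else 0 := by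
  rw [position, position, Finset.filter_insert]
  split_ifs with h
  · rw [Finset.card_insert_of_notMem fun hm => hy (Finset.mem_filter.1 hm).1]
  · rfl

open Classical in
/-- The incidence function of the complex of ordered simplices, where a cell is regarded as the
simplex on the union of its factors: the sign of `F ∖ {x}` in `F` is given by the position
of `x`. -/
noncomputable def incidence (F G : H.polyhedralComplex.Face) : ℤ :=
  if H.polyhedralComplex.IsFacet G F then
    ∑ x ∈ total F.1 \ total G.1, (-1) ^ position (total F.1) x else 0

theorem incidence_of_insert {F G : H.polyhedralComplex.Face} {x : Σ _ : Fin d, H.verts}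
    (hx : x ∉ total G.1) (h : insert x (total G.1) = total F.1) :
    incidence F G = (-1) ^ position (total F.1) x := by
  rw [incidence, if_pos (isFacet_iff_exists_insert.2 ⟨x, hx, h⟩), ← h,
    Finset.insert_sdiff_of_notMem _ hx,
    sdiff_self, Finset.bot_eq_empty, insert_empty_eq, Finset.sum_singleton]

theorem exists_insert_of_incidence_ne_zero {F G : H.polyhedralComplex.Face}
    (h : incidence F G ≠ 0) : ∃ x ∉ total G.1, insert x (total G.1) = total F.1 := by
  by_contra hn
  exact h (if_neg (mt isFacet_iff_exists_insert.1 hn))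

theorem sum_incidence_mul_incidence (F G : H.polyhedralComplex.Face) :
    ∑ K, incidence F K * incidence K G = 0 := by
  by_cases hex : ∃ K, incidence F K * incidence K G ≠ 0
  swap
  · exact Finset.sum_eq_zero fun K _ => not_not.1 fun h => hex ⟨K, h⟩
  obtain ⟨K, hK⟩ := hex
  obtain ⟨x, hxK, hxF⟩ := exists_insert_of_incidence_ne_zero (left_ne_zero_of_mul hK)
  obtain ⟨y, hyG, hyK⟩ := exists_insert_of_incidence_ne_zero (right_ne_zero_of_mul hK)
  have hyx : y ≠ x := by
    rintro rfl
    exact hxK (hyK ▸ Finset.mem_insert_self _ _)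
  have hxG : x ∉ total G.1 := fun h => hxK (hyK ▸ Finset.mem_insert_of_mem h)
  have hF : total F.1 = insert x (insert y (total G.1)) := by rw [hyK, hxF]
  -- the other cell between `G` and `F`
  obtain ⟨L, hL⟩ := exists_total_eq_erase F (x := y) (by
    obtain ⟨v, hv⟩ := G.2.1 y.1
    have hv' : (⟨y.1, v⟩ : Σ _ : Fin d, H.verts) ∈ total G.1 := mem_total.2 hv
    refine ⟨v, ?_, ?_⟩
    · have : (⟨y.1, v⟩ : Σ _ : Fin d, H.verts) ∈ total F.1 := by
        rw [hF]
        exact Finset.mem_insert_of_mem (Finset.mem_insert_of_mem hv')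
      exact mem_total.1 this
    · rintro rfl
      exact hyG hv')
  have hxL : insert x (total G.1) = total L.1 := by
    rw [hL, hF, Finset.insert_comm, Finset.erase_insert]
    simp [hyx, hyG]
  have hyL : y ∉ total L.1 := by rw [hL]; exact Finset.notMem_erase _ _
  have hLF : insert y (total L.1) = total F.1 := by
    rw [← hxL, hF, Finset.insert_comm]
  have hKL : K ≠ L := by
    rintro rfl
    exact hyL (hyK ▸ Finset.mem_insert_self _ _)
  rw [Finset.sum_eq_add K L hKL]
  · rw [incidence_of_insert hxK hxF, incidence_of_insert hyG hyK, incidence_of_insert hyL hLF,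
      incidence_of_insert hxG hxL, ← hxF, position_insert hxK, ← hyK, position_insert hyG,
      position_insert hyG]
    rw [hyK, hxF, ← hLF, position_insert hyL, ← hxL, position_insert hxG, position_insert hxG]
    have hne := snd_ne_snd F (x := x) (y := y) (hxF ▸ Finset.mem_insert_self _ _)
      (hLF ▸ Finset.mem_insert_self _ _) hyx.symm
    simp only [lt_irrefl, if_false, add_zero]
    rcases lt_or_gt_of_ne hne with h | h
    · rw [if_pos h, if_neg h.asymm]
      ring
    · rw [if_pos h, if_neg h.asymm]
      ring
  · rintro M - ⟨hMK, hML⟩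
    by_contra hM
    obtain ⟨x', hxM', hxF'⟩ := exists_insert_of_incidence_ne_zero (left_ne_zero_of_mul hM)
    obtain ⟨y', hyG', hyM'⟩ := exists_insert_of_incidence_ne_zero (right_ne_zero_of_mul hM)
    have hy' : y' ∈ total F.1 := by
      rw [← hxF', ← hyM']
      exact Finset.mem_insert_of_mem (Finset.mem_insert_self _ _)
    rw [hF, Finset.mem_insert, Finset.mem_insert] at hy'
    rcases hy' with rfl | rfl | h
    · exact hML (Subtype.ext (total_injective (hyM'.symm.trans hxL)))
    · exact hMK (Subtype.ext (total_injective (hyM'.symm.trans hyK)))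
    · exact hyG' h
  · exact fun h => absurd (Finset.mem_univ _) h
  · exact fun h => absurd (Finset.mem_univ _) h

theorem sum_incidence_edge (F : H.polyhedralComplex.Face) (hF : H.polyhedralComplex.dim F = 1) :
    ∑ G, incidence F G = 0 := by
  have hcard := dim_add F
  rw [hF] at hcard
  have hpos : ∀ i, 1 ≤ (F.1 i).card := fun i => Finset.card_pos.2 (F.2.1 i)
  -- exactly one factor is an edge, and the others are vertices
  obtain ⟨i, hi⟩ : ∃ i, 1 < (F.1 i).card := by
    by_contra! h
    have := Finset.sum_le_sum fun i (_ : i ∈ Finset.univ) => h i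
    simp only [Finset.sum_const, Finset.card_univ, Fintype.card_fin, smul_eq_mul, mul_one] at this
    omega
  have hrest : d - 1 ≤ ∑ j ∈ Finset.univ.erase i, (F.1 j).card := by
    have := Finset.sum_le_sum fun j (_ : j ∈ Finset.univ.erase i) => hpos j
    simpa using this
  have hsplit := Finset.add_sum_erase Finset.univ (fun j => (F.1 j).card) (Finset.mem_univ i)
  have hdpos : 0 < d := i.pos
  have hi2 : (F.1 i).card = 2 := by
    omega
  have hother : ∀ j, j ≠ i → (F.1 j).card = 1 := by
    intro j hj
    have hsplit' := Finset.add_sum_erase (Finset.univ.erase i) (fun j => (F.1 j).card)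
      (Finset.mem_erase.2 ⟨hj, Finset.mem_univ j⟩)
    have h1 := Finset.sum_le_sum fun l (_ : l ∈ (Finset.univ.erase i).erase j) => hpos l
    have h2 : ((Finset.univ.erase i).erase j).card = d - 1 - 1 := by
      rw [Finset.card_erase_of_mem (Finset.mem_erase.2 ⟨hj, Finset.mem_univ j⟩),
        Finset.card_erase_of_mem (Finset.mem_univ i), Finset.card_univ, Fintype.card_fin]
    rw [Finset.sum_const, h2, smul_eq_mul, mul_one] at h1
    have := hpos j
    have hd2 : 1 < d := by
      have h3 := i.2
      have h4 := j.2
      have h5 : j.1 ≠ i.1 := fun h => hj (Fin.ext h)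
      omega
    omega
  obtain ⟨a, b, hab, hFi⟩ : ∃ a b : H.verts, a < b ∧ F.1 i = {a, b} := by
    obtain ⟨a, b, hab, h⟩ := Finset.card_eq_two.1 hi2
    rcases lt_or_gt_of_ne hab with h1 | h1
    · exact ⟨a, b, h1, h⟩
    · exact ⟨b, a, h1, by rw [h, Finset.pair_comm]⟩
  have haF : a ∈ F.1 i := by simp [hFi]
  have hbF : b ∈ F.1 i := by simp [hFi]
  obtain ⟨A, hA⟩ := exists_total_eq_erase F (x := ⟨i, a⟩) ⟨b, hbF, hab.ne'⟩
  obtain ⟨B, hB⟩ := exists_total_eq_erase F (x := ⟨i, b⟩) ⟨a, haF, hab.ne⟩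
  have haT : (⟨i, a⟩ : Σ _ : Fin d, H.verts) ∈ total F.1 := mem_total.2 haF
  have hbT : (⟨i, b⟩ : Σ _ : Fin d, H.verts) ∈ total F.1 := mem_total.2 hbF
  have hAa : (⟨i, a⟩ : Σ _ : Fin d, H.verts) ∉ total A.1 := by
    rw [hA]; exact Finset.notMem_erase _ _
  have hBb : (⟨i, b⟩ : Σ _ : Fin d, H.verts) ∉ total B.1 := by
    rw [hB]; exact Finset.notMem_erase _ _
  have hba : (⟨i, b⟩ : Σ _ : Fin d, H.verts) ≠ ⟨i, a⟩ := fun h => by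
    cases h
    exact lt_irrefl _ hab
  have hAB : A ≠ B := by
    rintro rfl
    rw [hA] at hBb
    exact hBb (Finset.mem_erase.2 ⟨hba, hbT⟩)
  rw [Finset.sum_eq_add A B hAB]
  · rw [incidence_of_insert hAa (by rw [hA, Finset.insert_erase haT]),
      incidence_of_insert hBb (by rw [hB, Finset.insert_erase hbT])]
    -- `a` and `b` are consecutive elements of the cell
    have hpos : position (total F.1) ⟨i, b⟩ = position (total F.1) ⟨i, a⟩ + 1 := by
      rw [position, position, ← Finset.card_insert_of_notMem
        (a := (⟨i, a⟩ : Σ _ : Fin d, H.verts)) (by simp)]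
      congr 1
      ext ⟨j, v⟩
      simp only [Finset.mem_filter, Finset.mem_insert, mem_total]
      constructor
      · rintro ⟨hv, hvb⟩
        rcases lt_trichotomy j i with h | h | h
        · exact Or.inr ⟨hv, F.2.2.1 j i h v hv a haF⟩
        · subst h
          rw [hFi, Finset.mem_insert, Finset.mem_singleton] at hv
          rcases hv with rfl | rfl
          · exact Or.inl rfl
          · exact absurd hvb (lt_irrefl _)
        · exact absurd hvb (F.2.2.1 i j h b hbF v hv).asymm
      · rintro (h | ⟨hv, hva⟩)
        · cases h
          exact ⟨haF, hab⟩
        · exact ⟨hv, hva.trans hab⟩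
    rw [hpos, pow_succ]
    ring
  · rintro G - ⟨hGA, hGB⟩
    by_contra hG
    obtain ⟨⟨j, v⟩, hx, hxF⟩ := exists_insert_of_incidence_ne_zero hG
    have hvF : v ∈ F.1 j := by
      have : (⟨j, v⟩ : Σ _ : Fin d, H.verts) ∈ total F.1 := hxF ▸ Finset.mem_insert_self _ _
      exact mem_total.1 this
    by_cases hj : j = i
    · subst hj
      rw [hFi, Finset.mem_insert, Finset.mem_singleton] at hvF
      rcases hvF with rfl | rfl
      · refine hGA (Subtype.ext (total_injective ?_))
        rw [hA, ← hxF, Finset.erase_insert hx]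
      · refine hGB (Subtype.ext (total_injective ?_))
        rw [hB, ← hxF, Finset.erase_insert hx]
    · obtain ⟨w, hw⟩ := G.2.1 j
      have hwT : (⟨j, w⟩ : Σ _ : Fin d, H.verts) ∈ total G.1 := mem_total.2 hw
      have hwF : w ∈ F.1 j := by
        have : (⟨j, w⟩ : Σ _ : Fin d, H.verts) ∈ total F.1 := hxF ▸ Finset.mem_insert_of_mem hwT
        exact mem_total.1 this
      have hwv := Finset.card_le_one.1 (hother j hj).le w hwF v hvF
      exact hx (hwv ▸ hwT)
  · exact fun h => absurd (Finset.mem_univ _) h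
  · exact fun h => absurd (Finset.mem_univ _) h

theorem nonempty_orientation (H : DGraph d) : Nonempty H.labeledComplex.Orientation :=
  ⟨{ sign := incidence (H := H)
     sign_of_isFacet := by
      intro F G h
      obtain ⟨x, hx, hxF⟩ := isFacet_iff_exists_insert.1 h
      rw [incidence_of_insert hx hxF]
      exact neg_one_pow_eq_or ℤ _
     sign_of_not_isFacet := fun F G h => if_neg h
     sum_sign_edge := sum_incidence_edge
     sum_sign_mul_sign := sum_incidence_mul_incidence }⟩

end DGraph

/-! ### The exchange property of cointerval graphs -/

namespace DGraph

theorem image_eq_insert_image_tail {d : ℕ} (e : Fin (d + 1) → ℤ) :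
    Finset.univ.image e = insert (e 0) (Finset.univ.image fun i => e (Fin.succ i)) := by
  ext x
  simp only [Finset.mem_image, Finset.mem_univ, true_and, Finset.mem_insert, Fin.exists_fin_succ,
    eq_comm]

theorem image_tail_mem_layer {d : ℕ} {H : DGraph (d + 1)} {e : Fin (d + 1) → ℤ}
    (he : StrictMono e) (hH : Finset.univ.image e ∈ H.edges) :
    (Finset.univ.image fun i => e (Fin.succ i)) ∈ (H.layer (e 0)).edges := by
  refine Finset.mem_filter.2 ⟨Finset.mem_powersetCard.2 ⟨?_, ?_⟩, ?_⟩
  · intro x hx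
    obtain ⟨i, -, rfl⟩ := Finset.mem_image.1 hx
    exact Finset.mem_filter.2 ⟨H.edge_subset _ hH (Finset.mem_image_of_mem e (Finset.mem_univ _)),
      he (Fin.succ_pos i)⟩
  · have hinj : Function.Injective fun i => e (Fin.succ i) :=
      he.injective.comp (Fin.succ_injective d)
    rw [Finset.card_image_of_injective _ hinj, Finset.card_univ, Fintype.card_fin]
  · rwa [← image_eq_insert_image_tail]

theorem insert_mem_of_mem_layer {d : ℕ} {H : DGraph (d + 1)} {v : ℤ} {e : Finset ℤ}
    (he : e ∈ (H.layer v).edges) : insert v e ∈ H.edges :=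
  (Finset.mem_filter.1 he).2

/-- In an edge `e 0 < e 1 < ⋯` of a cointerval graph, any element but the last may be replaced by
a smaller vertex that still exceeds the preceding element. -/
theorem IsCointerval.exchange : ∀ {d : ℕ} {H : DGraph d}, H.IsCointerval → ∀ {e : Fin d → ℤ},
    StrictMono e → Finset.univ.image e ∈ H.edges → ∀ {i : Fin d}, i.1 + 1 < d →
    ∀ {v : ℤ}, v ∈ H.verts → v < e i → (∀ j < i, e j < v) →
    Finset.univ.image (Function.update e i v) ∈ H.edges
  | 0, _, _, _, _, _, i, _, _, _, _, _ => i.elim0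
  | 1, _, _, _, _, _, _, hi, _, _, _, _ => absurd hi (by omega)
  | d + 2, H, hH, e, he, heH, i, hi, v, hv, hvi, hj => by
    obtain ⟨hlayer, hsub⟩ := hH
    have he0 : e 0 ∈ H.verts :=
      H.edge_subset _ heH (Finset.mem_image_of_mem e (Finset.mem_univ _))
    have htail := image_tail_mem_layer he heH
    rw [image_eq_insert_image_tail]
    apply insert_mem_of_mem_layer
    induction i using Fin.cases with
    | zero =>
      rw [Function.update_self]
      simp only [Function.update_of_ne (Fin.succ_ne_zero _)]
      exact (hsub v hv (e 0) he0 hvi).2 htail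
    | succ i =>
      rw [Function.update_of_ne (Fin.succ_ne_zero i).symm]
      have h1 := (hlayer (e 0) he0).exchange (he.comp (Fin.strictMono_succ)) htail (i := i)
        (by simpa using hi) (v := v) (Finset.mem_filter.2 ⟨hv, hj 0 (Fin.succ_pos i)⟩) hvi
        (fun j hji => hj j.succ (Fin.succ_lt_succ_iff.2 hji))
      convert h1 using 2
      funext j
      by_cases hji : j = i
      · subst hji
        rw [Function.update_self, Function.update_self]
      · rw [Function.update_of_ne hji,
          Function.update_of_ne (fun h => hji (Fin.succ_injective _ h))]
        rfl

/-! ### The matching on the cells of `X_H` -/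

variable {d : ℕ} {H : DGraph d}

/-- The tuple `e` lists the elements of an edge of `H` in increasing order. -/
def IsEdgeTuple (H : DGraph d) (e : Fin d → H.verts) : Prop :=
  StrictMono e ∧ Finset.univ.image (fun i => (e i : ℤ)) ∈ H.edges

theorem IsCell.isEdgeTuple {φ : Fin d → Finset H.verts} (hφ : H.IsCell φ) {w : Fin d → H.verts}
    (hw : ∀ i, w i ∈ φ i) : H.IsEdgeTuple w :=
  ⟨fun i j hij => hφ.2.1 i j hij _ (hw i) _ (hw j), hφ.2.2 w hw⟩

/-- The edge `b` is lexicographically minimal among the edges with vertices in `W`. -/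
def IsLexMinEdge (H : DGraph d) (W : Set H.verts) (b : Fin d → H.verts) : Prop :=
  H.IsEdgeTuple b ∧ (∀ i, b i ∈ W) ∧
    ∀ e, H.IsEdgeTuple e → (∀ i, e i ∈ W) → ∀ i, (∀ j < i, e j = b j) → b i ≤ e i

theorem exists_isLexMinEdge {W : Set H.verts} {e : Fin d → H.verts} (he : H.IsEdgeTuple e)
    (heW : ∀ i, e i ∈ W) : ∃ b, H.IsLexMinEdge W b := by
  classical
  obtain ⟨b, hb, hmin⟩ := (Finset.univ.filter fun e : Fin d → H.verts =>
    H.IsEdgeTuple e ∧ ∀ i, e i ∈ W).exists_min_image (fun e => toLex e)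
    ⟨e, Finset.mem_filter.2 ⟨Finset.mem_univ _, he, heW⟩⟩
  have hb' := (Finset.mem_filter.1 hb).2
  refine ⟨b, hb'.1, hb'.2, fun w hw hwW i hi => ?_⟩
  by_contra! hlt
  exact absurd (hmin w (Finset.mem_filter.2 ⟨Finset.mem_univ _, hw, hwW⟩))
    (not_le_of_gt (show toLex w < toLex b from ⟨i, hi, hlt⟩))

theorem IsLexMinEdge.le_of_mem {W : Set H.verts} {b : Fin d → H.verts} (hb : H.IsLexMinEdge W b)
    {φ : Fin d → Finset H.verts} (hφ : H.IsCell φ) (hφW : ∀ i, ∀ v ∈ φ i, v ∈ W) {i : Fin d}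
    (hi : ∀ j < i, φ j = {b j}) {s : H.verts} (hs : s ∈ φ i) : b i ≤ s := by
  choose w hw using hφ.1
  have hw' : ∀ j, Function.update w i s j ∈ φ j := by
    intro j
    by_cases hj : j = i
    · subst hj; simpa using hs
    · simpa [Function.update_of_ne hj] using hw j
  have h := hb.2.2 _ (hφ.isEdgeTuple hw') (fun j => hφW j _ (hw' j)) i (fun j hj => by
    have := hw' j
    rwa [hi j hj, Finset.mem_singleton] at this)
  simpa using h

/-- Let `i` be the first index for which the factor `φ i` differs from the vertex `b i` of the
minimal edge.  Then adding `b i` to `φ i` yields a cell: this is where the exchange property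
enters. -/
theorem IsLexMinEdge.isCell_update (hH : H.IsCointerval) {W : Set H.verts} {b : Fin d → H.verts}
    (hb : H.IsLexMinEdge W b) {φ : Fin d → Finset H.verts} (hφ : H.IsCell φ)
    (hφW : ∀ i, ∀ v ∈ φ i, v ∈ W) {i : Fin d} (hi : ∀ j < i, φ j = {b j}) (hbi : b i ∉ φ i) :
    H.IsCell (Function.update φ i (insert (b i) (φ i))) := by
  have hlt : ∀ s ∈ φ i, b i < s := fun s hs =>
    lt_of_le_of_ne (hb.le_of_mem hφ hφW hi hs) fun h => hbi (h ▸ hs)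
  refine ⟨fun j => ?_, fun j l hjl s hs t ht => ?_, fun v hv => ?_⟩
  · by_cases hj : j = i
    · subst hj
      simp
    · rw [Function.update_of_ne hj]
      exact hφ.1 j
  · by_cases hj : j = i
    · subst hj
      rw [Function.update_of_ne hjl.ne'] at ht
      rw [Function.update_self, Finset.mem_insert] at hs
      rcases hs with rfl | hs
      · obtain ⟨u, hu⟩ := hφ.1 j
        exact (hlt u hu).trans (hφ.2.1 j l hjl u hu t ht)
      · exact hφ.2.1 j l hjl s hs t ht
    · rw [Function.update_of_ne hj] at hs
      by_cases hl : l = i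
      · subst hl
        rw [Function.update_self, Finset.mem_insert] at ht
        rcases ht with rfl | ht
        · rw [hi j hjl, Finset.mem_singleton] at hs
          subst hs
          exact hb.1.1 hjl
        · exact hφ.2.1 j l hjl s hs t ht
      · rw [Function.update_of_ne hl] at ht
        exact hφ.2.1 j l hjl s hs t ht
  · have hvφ : ∀ j, j ≠ i → v j ∈ φ j := fun j hj => by
      have := hv j
      rwa [Function.update_of_ne hj] at this
    have hvi := hv i
    rw [Function.update_self, Finset.mem_insert] at hvi
    rcases hvi with hvi | hvi
    swap
    · exact hφ.2.2 v fun j => if hj : j = i then hj ▸ hvi else hvφ j hj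
    have hvb : ∀ j < i, v j = b j := fun j hj => by
      have := hvφ j hj.ne
      rwa [hi j hj, Finset.mem_singleton] at this
    by_cases hid : i.1 + 1 < d
    · obtain ⟨s, hs⟩ := hφ.1 i
      have hw : ∀ j, Function.update v i s j ∈ φ j := by
        intro j
        by_cases hj : j = i
        · subst hj; simpa using hs
        · simpa [Function.update_of_ne hj] using hvφ j hj
      have hw' := hφ.isEdgeTuple hw
      have h := hH.exchange (e := fun j => ((Function.update v i s j : H.verts) : ℤ))
        (fun j l hjl => hw'.1 hjl) hw'.2 hid (b i).2 (by simpa using hlt s hs) (fun j hj => by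
          simp only [Function.update_of_ne hj.ne, hvb j hj]
          exact hb.1.1 hj)
      convert h using 2
      funext j
      by_cases hj : j = i
      · subst hj
        rw [Function.update_self, hvi]
      · rw [Function.update_of_ne hj, Function.update_of_ne hj]
    · have hvb' : v = b := by
        funext j
        rcases lt_trichotomy j i with h | h | h
        · exact hvb j h
        · rw [h, hvi]
        · have := j.2
          have : i.1 < j.1 := h
          omega
      rw [hvb']
      exact hb.1.2

open Classical in
/-- The number of initial factors of `φ` that agree with those of the vertex `b`. -/
noncomputable def agreement (b : Fin d → H.verts) (φ : Fin d → Finset H.verts) : ℕ :=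
  (Finset.univ.filter fun j => ∀ l ≤ j, φ l = {b l}).card

theorem agreement_eq {b : Fin d → H.verts} {φ : Fin d → Finset H.verts} {i : Fin d}
    (hi : ∀ j < i, φ j = {b j}) (hne : φ i ≠ {b i}) : agreement b φ = i := by
  classical
  rw [← Fin.card_Iio, agreement]
  congr 1
  ext j
  simp only [Finset.mem_filter, Finset.mem_univ, true_and, Finset.mem_Iio]
  exact ⟨fun h => lt_of_not_ge fun hij => hne (h i hij), fun h l hl => hi l (hl.trans_lt h)⟩

theorem exists_first_ne {b : Fin d → H.verts} {φ : Fin d → Finset H.verts}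
    (h : φ ≠ fun j => {b j}) : ∃ i, (∀ j < i, φ j = {b j}) ∧ φ i ≠ {b i} := by
  obtain ⟨j, hj⟩ := Function.ne_iff.1 h
  obtain ⟨i, hi, hmin⟩ := wellFounded_lt.has_min {j | φ j ≠ {b j}} ⟨j, hj⟩
  exact ⟨i, fun j hj => not_not.1 fun h => hmin j h hj, hi⟩

/-- A cell `φ` is lower if the vertex `b i` is missing in `φ i`, where `i` is the first index for
which `φ i` differs from `{b i}`.  It is matched with the cell obtained by adding `b i` to `φ i`. -/
def IsLower (b : Fin d → H.verts) (φ : Fin d → Finset H.verts) : Prop :=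
  ∃ i, (∀ j < i, φ j = {b j}) ∧ b i ∉ φ i

theorem agreement_eq_of_notMem {b : Fin d → H.verts} {φ : Fin d → Finset H.verts} {i : Fin d}
    (hi : ∀ j < i, φ j = {b j}) (hbi : b i ∉ φ i) : agreement b φ = i :=
  agreement_eq hi fun h => hbi (by simp [h])

theorem card_eq_one_of_dim_eq_zero {F : H.polyhedralComplex.Face}
    (hF : H.polyhedralComplex.dim F = 0) (i : Fin d) : (F.1 i).card = 1 := by
  have h1 := dim_add F
  have h2 : ∑ i : Fin d, 1 = ∑ i, (F.1 i).card := by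
    rw [← h1, hF]
    simp
  have h3 := (Finset.sum_eq_sum_iff_of_le fun i _ => Finset.card_pos.2 (F.2.1 i)).1 h2
  exact (h3 i (Finset.mem_univ i)).symm

theorem eq_of_dim_eq_zero_of_not_isLower {b : Fin d → H.verts} {F : H.polyhedralComplex.Face}
    (hF : H.polyhedralComplex.dim F = 0) (hlow : ¬ IsLower b F.1) : F.1 = fun j => {b j} := by
  by_contra h
  obtain ⟨i, hi, hne⟩ := exists_first_ne h
  obtain ⟨x, hx⟩ := Finset.card_eq_one.1 (card_eq_one_of_dim_eq_zero hF i)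
  refine hlow ⟨i, hi, fun hb => hne ?_⟩
  rw [hx, Finset.mem_singleton] at hb
  rw [hx, hb]

theorem IsLexMinEdge.exists_upper (hH : H.IsCointerval) {W : Set H.verts} {b : Fin d → H.verts}
    (hb : H.IsLexMinEdge W b) (F : H.polyhedralComplex.Face) (hFW : ∀ i, ∀ v ∈ F.1 i, v ∈ W)
    (hF : IsLower b F.1) : ∃ G : H.polyhedralComplex.Face, (∀ i, ∀ v ∈ G.1 i, v ∈ W) ∧
      H.polyhedralComplex.IsFacet F G ∧ ∀ K : H.polyhedralComplex.Face, IsLower b K.1 → K ≠ F →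
        H.polyhedralComplex.IsFacet K G → agreement b F.1 < agreement b K.1 := by
  obtain ⟨i, hi, hbi⟩ := hF
  let G : H.polyhedralComplex.Face := ⟨_, hb.isCell_update hH F.2 hFW hi hbi⟩
  have hGi : G.1 i = insert (b i) (F.1 i) := Function.update_self _ _ _
  have hGj : ∀ j, j ≠ i → G.1 j = F.1 j := fun j hj => Function.update_of_ne hj _ _
  have hFG : H.polyhedralComplex.IsFacet F G := by
    refine isFacet_iff_exists_insert.2 ⟨⟨i, b i⟩, fun h => hbi (mem_total.1 h), ?_⟩
    ext ⟨j, v⟩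
    rw [Finset.mem_insert, mem_total, mem_total]
    by_cases hj : j = i
    · subst hj
      simp [hGi]
    · simp [hGj j hj, hj]
  refine ⟨G, fun j v hv => ?_, hFG, fun K hK hKF hKG => ?_⟩
  · by_cases hj : j = i
    · subst hj
      rw [hGi, Finset.mem_insert] at hv
      rcases hv with rfl | hv
      · exact hb.2.1 j
      · exact hFW j v hv
    · rw [hGj j hj] at hv
      exact hFW j v hv
  · obtain ⟨l, hl, hbl⟩ := hK
    rw [agreement_eq_of_notMem hi hbi, agreement_eq_of_notMem hl hbl]
    have hKG' := isFacet_iff.1 hKG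
    have hFG' := isFacet_iff.1 hFG
    have hbK : b i ∈ K.1 i := by
      by_contra hbK
      refine hKF (Subtype.ext (eq_of_subset_of_card (fun j => ?_) (by omega)))
      by_cases hj : j = i
      · subst hj
        intro v hv
        have hv' := hKG'.1 j hv
        rw [hGi, Finset.mem_insert] at hv'
        rcases hv' with rfl | hv'
        · exact absurd hv hbK
        · exact hv'
      · rw [← hGj j hj]
        exact hKG'.1 j
    rcases lt_trichotomy l i with h | h | h
    · -- here `K l` is a nonempty subset of `F l = {b l}`
      have h1 : K.1 l ⊆ {b l} := by
        rw [← hi l h, ← hGj l h.ne]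
        exact hKG'.1 l
      obtain ⟨v, hv⟩ := K.2.1 l
      exact absurd (Finset.mem_singleton.1 (h1 hv) ▸ hv) hbl
    · exact absurd (h ▸ hbK) hbl
    · exact h

theorem exists_lower {b : Fin d → H.verts} (F : H.polyhedralComplex.Face)
    (hF : ¬ IsLower b F.1) (hdim : H.polyhedralComplex.dim F ≠ 0) :
    ∃ G : H.polyhedralComplex.Face, H.polyhedralComplex.IsFacet G F ∧
      ∀ K : H.polyhedralComplex.Face, ¬ IsLower b K.1 → K ≠ F →
        H.polyhedralComplex.IsFacet G K → agreement b K.1 < agreement b F.1 := by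
  have hne : F.1 ≠ fun j => {b j} := by
    intro h
    have h1 := dim_add F
    rw [h] at h1
    simp at h1
    exact hdim h1
  obtain ⟨i, hi, hFi⟩ := exists_first_ne hne
  have hbi : b i ∈ F.1 i := not_not.1 fun h => hF ⟨i, hi, h⟩
  obtain ⟨G, hG⟩ := exists_total_eq_erase F (x := ⟨i, b i⟩) (by
    by_contra! h
    exact hFi (Finset.eq_singleton_iff_unique_mem.2 ⟨hbi, h⟩))
  have hbT : (⟨i, b i⟩ : Σ _ : Fin d, H.verts) ∈ total F.1 := mem_total.2 hbi
  have hGF : H.polyhedralComplex.IsFacet G F :=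
    isFacet_iff_exists_insert.2 ⟨⟨i, b i⟩, by rw [hG]; exact Finset.notMem_erase _ _,
      by rw [hG, Finset.insert_erase hbT]⟩
  have hGmem : ∀ j v, v ∈ F.1 j → (⟨j, v⟩ : Σ _ : Fin d, H.verts) ≠ ⟨i, b i⟩ → v ∈ G.1 j := by
    intro j v hv hjv
    have : (⟨j, v⟩ : Σ _ : Fin d, H.verts) ∈ total G.1 := by
      rw [hG]
      exact Finset.mem_erase.2 ⟨hjv, mem_total.2 hv⟩
    exact mem_total.1 this
  refine ⟨G, hGF, fun K hK hKF hGK => ?_⟩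
  have hGF' := isFacet_iff.1 hGF
  have hGK' := isFacet_iff.1 hGK
  rw [agreement_eq hi hFi]
  by_contra! hle
  have hK' : ∀ j < i, K.1 j = {b j} := by
    by_contra! h
    obtain ⟨j, hj, hjK⟩ := h
    obtain ⟨l, hl, hlK⟩ := exists_first_ne (b := b) (φ := K.1) fun h => hjK (congrFun h j)
    rw [agreement_eq hl hlK] at hle
    exact hjK (hl j (lt_of_lt_of_le hj hle))
  have hbK : b i ∈ K.1 i := not_not.1 fun h => hK ⟨i, hK', h⟩
  refine hKF (Subtype.ext (eq_of_subset_of_card (fun j v hv => ?_) (by omega)).symm)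
  by_cases hjv : (⟨j, v⟩ : Σ _ : Fin d, H.verts) = ⟨i, b i⟩
  · cases hjv
    exact hbK
  · exact hGK'.1 j (hGmem j v hv hjv)

theorem admitsMatching (hH : H.IsCointerval) : H.labeledComplex.AdmitsMatching := by
  intro α
  classical
  have hlabel : ∀ F, (fun v => (H.labeledComplex.label F v : ℤ)) ≤ α →
      ∀ i, ∀ v ∈ F.1 i, v ∈ {v | 1 ≤ α v} := by
    intro F hF i v hv
    have h1 : (H.labeledComplex.label F v : ℤ) ≤ α v := hF v
    rw [label_apply, if_pos ⟨i, hv⟩] at h1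
    simpa using h1
  by_cases hex : ∃ F, (fun v => (H.labeledComplex.label F v : ℤ)) ≤ α
  swap
  · exact ⟨fun _ => True, fun _ => 0, fun F hF => absurd ⟨F, hF⟩ hex,
      fun _ _ h => absurd trivial h, fun _ _ h => absurd trivial h⟩
  obtain ⟨F₀, hF₀⟩ := hex
  have hα : ∀ v, 0 ≤ α v := fun v => le_trans (Int.natCast_nonneg _) (hF₀ v)
  choose w hw using F₀.2.1
  obtain ⟨b, hb⟩ := exists_isLexMinEdge (IsCell.isEdgeTuple F₀.2 hw)
    (fun i => hlabel F₀ hF₀ i _ (hw i))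
  refine ⟨fun F => IsLower b F.1, fun F => agreement b F.1, fun F hF hlow => ?_,
    fun F _ hlow hdim => exists_lower F hlow hdim, fun F G hF hG hF0 hG0 => ?_⟩
  · obtain ⟨G, hGα, h⟩ := hb.exists_upper hH F (hlabel F hF) hlow
    refine ⟨G, fun v => ?_, h⟩
    have hlab := label_apply (H := H) G v
    change (H.labeledComplex.label G v : ℤ) ≤ α v
    split_ifs at hlab with hv
    all_goals refine (congrArg (Nat.cast (R := ℤ)) hlab).trans_le ?_
    · obtain ⟨i, hi⟩ := hv
      simpa using hGα i v hi
    · simpa using hα v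
  · exact Subtype.ext ((eq_of_dim_eq_zero_of_not_isLower hF0 hF).trans
      (eq_of_dim_eq_zero_of_not_isLower hG0 hG).symm)

end DGraph

/-! ### The cellular resolution and its Betti numbers -/

namespace DGraph

open MvPolynomial GradedMatrix LabeledPolyhedralComplex

variable {d : ℕ} {H : DGraph d} {k : Type*} [Field k]

theorem monomial_label_vertex (F : H.labeledComplex.Face) {w : Fin d → H.verts}
    (hw : F.1 = fun i => {w i}) :
    monomial (H.labeledComplex.label F) (1 : k) =
      ∏ v ∈ Finset.univ.filter
        (fun v : H.verts => (v : ℤ) ∈ Finset.univ.image fun i => (w i : ℤ)), X v := by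
  classical
  have h : H.labeledComplex.label F = ∑ v ∈ Finset.univ.filter
      (fun v : H.verts => (v : ℤ) ∈ Finset.univ.image fun i => (w i : ℤ)), Finsupp.single v 1 := by
    ext v
    rw [label_apply, Finsupp.finsetSum_apply]
    simp only [Finsupp.single_apply, Finset.sum_ite_eq', Finset.mem_filter, Finset.mem_univ,
      true_and, Finset.mem_image, hw, Finset.mem_singleton]
    refine if_congr (exists_congr fun i => ?_) rfl rfl
    rw [eq_comm, Subtype.ext_iff]
  rw [h, monomial_sum_one]
  rfl

theorem range_aug (o : H.labeledComplex.Orientation) :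
    LinearMap.range (Fintype.linearCombination (MvPolynomial H.verts k)
      (H.labeledComplex.cellularComplex k o).aug) = H.edgeIdeal k := by
  rw [Fintype.range_linearCombination]
  refine congrArg (Submodule.span (MvPolynomial H.verts k)) (Set.ext fun m => ?_)
  constructor
  · rintro ⟨⟨F, hF⟩, rfl⟩
    choose w hw using fun i => Finset.card_eq_one.1 (card_eq_one_of_dim_eq_zero hF i)
    exact ⟨_, F.2.2.2 w fun i => by simp [hw i], monomial_label_vertex F (funext hw)⟩
  · rintro ⟨e, he, rfl⟩
    have hcard := H.edge_card e he
    let w : Fin d → H.verts := fun i =>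
      ⟨e.orderEmbOfFin hcard i, H.edge_subset e he (Finset.orderEmbOfFin_mem e hcard i)⟩
    have hwe : Finset.univ.image (fun i => (w i : ℤ)) = e := by
      apply Finset.coe_injective
      rw [Finset.coe_image, Finset.coe_univ, Set.image_univ]
      exact Finset.range_orderEmbOfFin e hcard
    let F : H.polyhedralComplex.Face := ⟨fun i => {w i}, fun i => Finset.singleton_nonempty _, by
      intro i j hij s hs t ht
      rw [Finset.mem_singleton] at hs ht
      subst hs ht
      exact (e.orderEmbOfFin hcard).strictMono hij, by
      intro v hv
      have : v = w := funext fun i => Finset.mem_singleton.1 (hv i)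
      rw [this, hwe]
      exact he⟩
    have hF : H.polyhedralComplex.dim F = 0 := by
      have h1 := dim_add F
      have h2 : ∑ i, (F.1 i).card = d := by simp [F]
      omega
    refine ⟨⟨F, hF⟩, ?_⟩
    have h := monomial_label_vertex (k := k) (H := H) F (w := w) rfl
    rw [hwe] at h
    exact h

theorem isFreeResolution (hH : H.IsCointerval) (o : H.labeledComplex.Orientation) :
    (H.labeledComplex.cellularComplex k o).IsFreeResolution (H.edgeIdeal k) :=
  ⟨range_aug o,
    (GradedFreeSequence.exact_aug_iff _).2 (strandExact_augCoef k o (admitsMatching hH)),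
    fun i => (GradedFreeSequence.exact_diff_iff _ i).2
      (strandExact_diffCoef k o (admitsMatching hH) i)⟩

/-- The cellular complex is minimal, since the labels of a face and of its facets have different
degrees. -/
theorem isMinimal (o : H.labeledComplex.Orientation) :
    (H.labeledComplex.cellularComplex k o).IsMinimal := by
  intro i G F
  rw [← Set.image_univ, mem_ideal_span_X_image]
  intro m hm
  by_contra! hall
  have hm0 : m = 0 := by
    ext v
    exact hall v (Set.mem_univ v)
  have hdeg := (H.labeledComplex.cellularComplex k o).diff_homogeneous i G F m hm
  have h1 := dim_add_eq_sum_label G.1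
  have h2 := dim_add_eq_sum_label F.1
  have h3 : ∀ v, H.labeledComplex.label F.1 v = H.labeledComplex.label G.1 v := by
    intro v
    have h4 : (m v : ℤ) = (H.labeledComplex.label F.1 v : ℤ) - H.labeledComplex.label G.1 v :=
      hdeg v
    rw [hm0, Finsupp.coe_zero, Pi.zero_apply] at h4
    omega
  rw [Finset.sum_congr rfl fun v _ => h3 v, ← h1, F.2, G.2] at h2
  omega

theorem isBettiNumber (hH : H.IsCointerval) (i : ℕ) (α : H.verts → ℤ) :
    IsBettiNumber (H.edgeIdeal k) i α (Nat.card {F : H.labeledComplex.Face //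
      H.labeledComplex.dim F = i ∧ (fun v => (H.labeledComplex.label F v : ℤ)) = α}) := by
  obtain ⟨o⟩ := nonempty_orientation H
  refine ⟨⟨_, isFreeResolution hH o, isMinimal o⟩, fun F hF hFm => ?_⟩
  rw [GradedFreeSequence.rank_eq_rank hF hFm (isFreeResolution hH o) (isMinimal o)]
  exact Nat.card_congr (Equiv.subtypeSubtypeEquivSubtypeInter (fun F => H.labeledComplex.dim F = i)
    (fun F => (fun v => (H.labeledComplex.label F v : ℤ)) = α))

theorem sum_squarefreeDegree {α : Finset ℤ} (hα : α ⊆ H.verts) :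
    ∑ v, H.squarefreeDegree α v = α.card := by
  change ∑ v : H.verts, (if (v : ℤ) ∈ α then (1 : ℤ) else 0) = _
  rw [Finset.sum_coe_sort H.verts fun v => if v ∈ α then (1 : ℤ) else 0, Finset.sum_ite_mem,
    Finset.inter_eq_right.2 hα]
  simp

theorem dim_add_of_label_eq {α : Finset ℤ} (hα : α ⊆ H.verts) {F : H.labeledComplex.Face}
    (hF : (fun v => (H.labeledComplex.label F v : ℤ)) = H.squarefreeDegree α) :
    H.labeledComplex.dim F + d = α.card := by
  have h := sum_squarefreeDegree hα
  rw [← hF, ← Nat.cast_sum, ← dim_add_eq_sum_label] at h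
  exact_mod_cast h

open Classical in
/-- A face of dimension `|α| - d` of `X_{H[α]}` uses all vertices in `α`, so that such faces are
the faces of `X_H` with label `α`. -/
theorem card_faces_induce {α : Finset ℤ} (hα : α ⊆ H.verts) {i : ℕ} (hi : i + d = α.card) :
    Nat.card {F : H.labeledComplex.Face // H.labeledComplex.dim F = i ∧
      (fun v => (H.labeledComplex.label F v : ℤ)) = H.squarefreeDegree α} =
    Nat.card {F : (H.induce α hα).polyhedralComplex.Face //
      (H.induce α hα).polyhedralComplex.dim F = i} := by
  let ι : (H.induce α hα).verts ↪ H.verts := ⟨fun v => ⟨v.1, hα v.2⟩, fun v w h =>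
    Subtype.ext (congrArg (fun u : H.verts => (u : ℤ)) h)⟩
  have hι : ∀ v : H.verts, v.1 ∈ α → ∃ u, ι u = v := fun v hv => ⟨⟨v.1, hv⟩, rfl⟩
  have hcell : ∀ φ, (H.induce α hα).IsCell φ ↔ H.IsCell fun i => (φ i).map ι := by
    intro φ
    refine and_congr (by simp) (and_congr ?_ ?_)
    · simp only [Finset.forall_mem_map]
      rfl
    · constructor
      · intro h v hv
        choose w hw hwv using fun i => Finset.mem_map.1 (hv i)
        have := (Finset.mem_filter.1 (h w hw)).1
        rw [← funext hwv]
        exact this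
      · intro h v hv
        refine Finset.mem_filter.2
          ⟨h (fun i => ι (v i)) fun i => Finset.mem_map_of_mem _ (hv i), ?_⟩
        intro x hx
        obtain ⟨i, -, rfl⟩ := Finset.mem_image.1 hx
        exact (v i).2
  have hdim : ∀ (F : (H.induce α hα).polyhedralComplex.Face) (F' : H.polyhedralComplex.Face),
      (∀ i, F'.1 i = (F.1 i).map ι) →
      H.polyhedralComplex.dim F' = (H.induce α hα).polyhedralComplex.dim F := by
    intro F F' hF
    have h1 := dim_add F
    have h2 := dim_add F'
    have h3 : ∑ i, (F'.1 i).card = ∑ i, (F.1 i).card :=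
      Finset.sum_congr rfl fun i _ => by rw [hF i, Finset.card_map]
    omega
  symm
  refine Nat.card_eq_of_bijective (fun F => ⟨⟨fun i => (F.1.1 i).map ι, (hcell _).1 F.1.2⟩, ?_, ?_⟩)
    ⟨?_, ?_⟩
  · exact (hdim F.1 _ fun i => rfl).trans F.2
  · -- the label divides `x^α` and has the same degree
    set F' : H.labeledComplex.Face := ⟨fun i => (F.1.1 i).map ι, (hcell _).1 F.1.2⟩ with hF'
    have hd : H.labeledComplex.dim F' = i := (hdim F.1 _ fun i => rfl).trans F.2
    have hle : ∀ v ∈ Finset.univ, (H.labeledComplex.label F' v : ℤ) ≤ H.squarefreeDegree α v := by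
      intro v _
      rw [label_apply, squarefreeDegree]
      by_cases h : ∃ i, v ∈ F'.1 i
      · obtain ⟨j, hj⟩ := h
        obtain ⟨u, -, rfl⟩ := Finset.mem_map.1 hj
        rw [if_pos ⟨j, hj⟩, if_pos]
        · rfl
        · exact u.2
      · rw [if_neg h]
        split_ifs <;> simp
    have hsum : ∑ v, (H.labeledComplex.label F' v : ℤ) = ∑ v, H.squarefreeDegree α v := by
      rw [sum_squarefreeDegree hα, ← Nat.cast_sum, ← dim_add_eq_sum_label, hd, hi]
    exact funext fun v => (Finset.sum_eq_sum_iff_of_le hle).1 hsum v (Finset.mem_univ v)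
  · rintro ⟨⟨φ, hφ⟩, hF⟩ ⟨⟨ψ, hψ⟩, hG⟩ h
    have h1 : (fun i => (φ i).map ι) = fun i => (ψ i).map ι :=
      congrArg (fun F => F.1.1) h
    have h2 : φ = ψ := funext fun i => Finset.map_injective ι (congrFun h1 i)
    subst h2
    rfl
  · rintro ⟨F, hFi, hFα⟩
    have hmem : ∀ j, ∀ v ∈ F.1 j, v.1 ∈ α := by
      intro j v hv
      have h1 : (H.labeledComplex.label F v : ℤ) = H.squarefreeDegree α v := congrFun hFα v
      rw [label_apply, if_pos ⟨j, hv⟩, squarefreeDegree] at h1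
      by_contra h
      rw [if_neg h] at h1
      simp at h1
    let φ : Fin d → Finset (H.induce α hα).verts := fun j =>
      Finset.univ.filter fun u => ι u ∈ F.1 j
    have hφ : (fun j => (φ j).map ι) = F.1 := by
      funext j
      ext v
      rw [Finset.mem_map]
      constructor
      · rintro ⟨u, hu, rfl⟩
        exact (Finset.mem_filter.1 hu).2
      · intro hv
        obtain ⟨u, rfl⟩ := hι v (hmem j v hv)
        exact ⟨u, Finset.mem_filter.2 ⟨Finset.mem_univ _, hv⟩, rfl⟩
    let G : (H.induce α hα).polyhedralComplex.Face := ⟨φ, (hcell φ).2 (hφ.symm ▸ F.2)⟩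
    refine ⟨⟨G, ?_⟩, ?_⟩
    · rw [← hdim G F fun j => (congrFun hφ j).symm]
      exact hFi
    · exact Subtype.ext (Subtype.ext hφ)

end DGraph

theorem mainTheorem1 (k : Type*) [Field k] {d : ℕ} (H : DGraph d) (hH : H.IsCointerval) :
    H.labeledComplex.SupportsMinimalResolution (H.edgeIdeal k) ∧
    (∀ (i : ℕ) (α : Finset ℤ) (hα : α ⊆ H.verts),
      (i + d ≠ α.card → IsBettiNumber (H.edgeIdeal k) i (H.squarefreeDegree α) 0) ∧
      (i + d = α.card → IsBettiNumber (H.edgeIdeal k) i (H.squarefreeDegree α)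
        (Nat.card {F : (H.induce α hα).polyhedralComplex.Face //
          (H.induce α hα).polyhedralComplex.dim F = i}))) ∧
    ∀ (i : ℕ) (α : H.verts → ℤ), IsBettiNumber (H.edgeIdeal k) i α
      (Nat.card {F : H.labeledComplex.Face //
        H.labeledComplex.dim F = i ∧ (fun v => (H.labeledComplex.label F v : ℤ)) = α}) := by
  refine ⟨⟨H.nonempty_orientation, fun o => ⟨DGraph.isFreeResolution hH o, DGraph.isMinimal o⟩⟩,
    fun i α hα => ⟨fun hi => ?_, fun hi => ?_⟩, fun i α => DGraph.isBettiNumber hH i α⟩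
  · have h := DGraph.isBettiNumber (k := k) hH i (H.squarefreeDegree α)
    have hempty : IsEmpty {F : H.labeledComplex.Face // H.labeledComplex.dim F = i ∧
        (fun v => (H.labeledComplex.label F v : ℤ)) = H.squarefreeDegree α} :=
      ⟨fun F => hi (by rw [← DGraph.dim_add_of_label_eq hα F.2.2, F.2.1])⟩
    rwa [Nat.card_of_isEmpty] at h
  · rw [← DGraph.card_faces_induce hα hi]
    exact DGraph.isBettiNumber hH i _
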